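/- Let $M$ be a Hopf–von Neumann algebra on a complex Hilbert space $\mathfrak H$: a von Neumann algebra $M\subseteq B(\mathfrak H)$ together with an injective normal unital $*$-homomorphism $\Gamma:M\to M\bar\otimes M$ (the spatial von Neumann tensor product) such that $(\Gamma\otimes\iota)\circ\Gamma=(\iota\otimes\Gamma)\circ\Gamma$, where $\iota$ is the identity map of $M$. Let $A=M_*$ be the predual of $M$, i.e. the space of normal functionals on $M$ with the norm of $M^*$, and let $G$ be the intrinsic group of $M$, i.e. the group of all invertible $x\in M$ with $\Gamma(x)=x\otimes x$, with the weak operator topology. Then: (0) For $x\in G$ the map $\alpha_x(m)=xmx^{-1}$ is a $*$-automorphism of $M$, $x\mapsto\alpha_x$ is a homomorphism from $G$ into $\mathrm{Aut}(M)$, and for each $m\in M$ the map $x\mapsto\alpha_x(m)$ is weak$^*$-continuous (for the topology $\sigma(M,M_*)$). (a) For $a,b\in A$ there is a unique normal functional $a\otimes b$ on $M\bar\otimes M$ with $(a\otimes b)(m\otimes n)=a(m)b(n)$ for all $m,n\in M$. Setting $(ab)(m)=(a\otimes b)(\Gamma(m))$ for $m\in M$ defines a bilinear associative product on $A$ with $\|ab\|\le\|a\|\,\|b\|$,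 and $A$ is complete; that is, $A$ is a Banach algebra. (b) For each $x\in G$, the map $\beta_x=(\alpha_{x^{-1}})_*$, i.e. $\beta_x(a)(m)=a(x^{-1}mx)$, is an isometric linear bijection of $A$ onto $A$ with $\beta_x(ab)=\beta_x(a)\beta_x(b)$ for all $a,b\in A$; that is, $\beta_x$ is an isometric algebra automorphism of $A$. Moreover $x\mapsto\beta_x$ is a homomorphism and $x\mapsto\beta_x(a)$ is norm continuous on $G$ for each $a\in A$, so that $\beta$ is an action of $G$ on the Banach algebra $A$. In particular, these conclusions also hold for $G$ with the discrete topology. -/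

import Mathlib

open scoped TensorProduct InnerProductSpace Topology

noncomputable section

namespace HopfVN

/-! ### Hilbert space tensor products and elementary tensors of operators -/

/-- The Hilbert space tensor product: the completion of the algebraic tensor product. -/
abbrev HilbertTensor (H K : Type*) [NormedAddCommGroup H] [InnerProductSpace ℂ H]
    [NormedAddCommGroup K] [InnerProductSpace ℂ K] : Type _ :=
  UniformSpace.Completion (H ⊗[ℂ] K)

section Operators

variable {H K : Type*} [NormedAddCommGroup H] [InnerProductSpace ℂ H]
  [NormedAddCommGroup K] [InnerProductSpace ℂ K]

/-- The elementary tensor of two vectors in the Hilbert space tensor product. -/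
def vecTensor (ξ : H) (η : K) : HilbertTensor H K :=
  ((ξ ⊗ₜ[ℂ] η : H ⊗[ℂ] K) : HilbertTensor H K)

/-- The operator `S ⊗ T` on the Hilbert space tensor product. -/
def opTensor (S : H →L[ℂ] H) (T : K →L[ℂ] K) : HilbertTensor H K →L[ℂ] HilbertTensor H K :=
  (TensorProduct.mapL S T).completion

theorem opTensor_vecTensor (S : H →L[ℂ] H) (T : K →L[ℂ] K) (ξ : H) (η : K) :
    opTensor S T (vecTensor ξ η) = vecTensor (S ξ) (T η) := by
  simp [opTensor, vecTensor]

theorem opTensor_mul (S S' : H →L[ℂ] H) (T T' : K →L[ℂ] K) :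
    opTensor (S * S') (T * T') = opTensor S T * opTensor S' T' := by
  ext x
  refine UniformSpace.Completion.induction_on x
    (isClosed_eq (by fun_prop) (by fun_prop)) fun y => ?_
  simp [opTensor, TensorProduct.mapL_mul]

theorem opTensor_one : opTensor (1 : H →L[ℂ] H) (1 : K →L[ℂ] K) = 1 := by
  ext x
  refine UniformSpace.Completion.induction_on x
    (isClosed_eq (by fun_prop) (by fun_prop)) fun y => ?_
  simp [opTensor, ContinuousLinearMap.one_def]

end Operators

/-! ### Von Neumann algebras: generation, tensor products, normal functionals, preduals -/

section VonNeumann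

variable {H K : Type*} [NormedAddCommGroup H] [InnerProductSpace ℂ H] [CompleteSpace H]
  [NormedAddCommGroup K] [InnerProductSpace ℂ K] [CompleteSpace K]

/-- The von Neumann algebra generated by a set `s` of operators: the double commutant of
`s ∪ star s`. -/
def generated (s : Set (H →L[ℂ] H)) : VonNeumannAlgebra H where
  toStarSubalgebra :=
    StarSubalgebra.centralizer ℂ (StarSubalgebra.centralizer ℂ s : Set (H →L[ℂ] H))
  centralizer_centralizer' := by
    change Set.centralizer (Set.centralizer
      ((StarSubalgebra.centralizer ℂ
        (StarSubalgebra.centralizer ℂ s : Set (H →L[ℂ] H)) : Set (H →L[ℂ] H)))) =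
      ((StarSubalgebra.centralizer ℂ
        (StarSubalgebra.centralizer ℂ s : Set (H →L[ℂ] H)) : Set (H →L[ℂ] H)))
    rw [StarSubalgebra.coe_centralizer_centralizer, Set.centralizer_centralizer_centralizer]

/-- The (spatial) von Neumann algebra tensor product of `M` and `N`: the von Neumann algebra
on the Hilbert space tensor product generated by the operators `m ⊗ n`, `m ∈ M`, `n ∈ N`. -/
def vnTensor (M : VonNeumannAlgebra H) (N : VonNeumannAlgebra K) :
    VonNeumannAlgebra (HilbertTensor H K) :=
  generated {T | ∃ m ∈ M, ∃ n ∈ N, T = opTensor m n}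

/-- The type of elements of a von Neumann algebra, with its C⋆-algebra structure. -/
abbrev Elem (M : VonNeumannAlgebra H) : Type _ := M.toStarSubalgebra

theorem opTensor_mem (M : VonNeumannAlgebra H) (N : VonNeumannAlgebra K)
    (m : Elem M) (n : Elem N) :
    opTensor (m : H →L[ℂ] H) (n : K →L[ℂ] K) ∈ (vnTensor M N).toStarSubalgebra :=
  StarAlgebra.adjoin_le_centralizer_centralizer ℂ _
    (StarAlgebra.subset_adjoin ℂ _ ⟨m, m.2, n, n.2, rfl⟩)

/-- The elementary tensor `m ⊗ n` as an element of the von Neumann tensor product. -/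
def elemTensor {M : VonNeumannAlgebra H} {N : VonNeumannAlgebra K} (m : Elem M) (n : Elem N) :
    Elem (vnTensor M N) :=
  ⟨opTensor (m : H →L[ℂ] H) (n : K →L[ℂ] K), opTensor_mem M N m n⟩

/-- A functional on a von Neumann algebra is normal (i.e. ultraweakly continuous) if it has the
form `m ↦ ∑ₙ ⟨m ξₙ, ηₙ⟩` with `∑ₙ ‖ξₙ‖² < ∞` and `∑ₙ ‖ηₙ‖² < ∞`. -/
def IsNormalFunctional (M : VonNeumannAlgebra H) (φ : Elem M → ℂ) : Prop :=
  ∃ ξ η : ℕ → H, Summable (fun n => ‖ξ n‖ ^ 2) ∧ Summable (fun n => ‖η n‖ ^ 2) ∧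
    ∀ m : Elem M, HasSum (fun n => ⟪η n, (m : H →L[ℂ] H) (ξ n)⟫_ℂ) (φ m)

theorem IsNormalFunctional.zero (M : VonNeumannAlgebra H) :
    IsNormalFunctional M (fun _ => 0) :=
  ⟨fun _ => 0, fun _ => 0, by simp, by simp, fun m => by simp⟩

theorem IsNormalFunctional.add {M : VonNeumannAlgebra H} {φ ψ : Elem M → ℂ}
    (hφ : IsNormalFunctional M φ) (hψ : IsNormalFunctional M ψ) :
    IsNormalFunctional M (fun m => φ m + ψ m) := by
  obtain ⟨ξ, η, hξ, hη, h⟩ := hφ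
  obtain ⟨ξ', η', hξ', hη', h'⟩ := hψ
  let e : ℕ ≃ ℕ ⊕ ℕ := Equiv.natSumNatEquivNat.symm
  refine ⟨fun n => Sum.elim ξ ξ' (e n), fun n => Sum.elim η η' (e n), ?_, ?_, fun m => ?_⟩
  · refine (e.summable_iff (f := fun s => ‖Sum.elim ξ ξ' s‖ ^ 2)).2 ?_
    exact (HasSum.sum (f := fun s => ‖Sum.elim ξ ξ' s‖ ^ 2) hξ.hasSum hξ'.hasSum).summable
  · refine (e.summable_iff (f := fun s => ‖Sum.elim η η' s‖ ^ 2)).2 ?_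
    exact (HasSum.sum (f := fun s => ‖Sum.elim η η' s‖ ^ 2) hη.hasSum hη'.hasSum).summable
  · refine (e.hasSum_iff
      (f := fun s => ⟪Sum.elim η η' s, (m : H →L[ℂ] H) (Sum.elim ξ ξ' s)⟫_ℂ)).2 ?_
    exact HasSum.sum
      (f := fun s => ⟪Sum.elim η η' s, (m : H →L[ℂ] H) (Sum.elim ξ ξ' s)⟫_ℂ) (h m) (h' m)

theorem IsNormalFunctional.smul {M : VonNeumannAlgebra H} {φ : Elem M → ℂ} (c : ℂ)
    (hφ : IsNormalFunctional M φ) : IsNormalFunctional M (fun m => c * φ m) := by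
  obtain ⟨ξ, η, hξ, hη, h⟩ := hφ
  refine ⟨fun n => c • ξ n, η, ?_, hη, fun m => ?_⟩
  · simpa [norm_smul, mul_pow] using hξ.mul_left (‖c‖ ^ 2)
  · simpa [inner_smul_right] using (h m).mul_left c

/-- The predual `M_*`: the space of normal functionals on `M`, with the norm of the dual
space `M^*`. -/
def predual (M : VonNeumannAlgebra H) : Submodule ℂ (StrongDual ℂ (Elem M)) where
  carrier := {φ | IsNormalFunctional M φ}
  zero_mem' := IsNormalFunctional.zero M
  add_mem' hφ hψ := IsNormalFunctional.add hφ hψ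
  smul_mem' c _ hφ := IsNormalFunctional.smul c hφ

/-- A map between von Neumann algebras is normal (i.e. ultraweakly continuous, when linear) if
composition with it carries normal functionals to normal functionals. -/
def IsNormalMap {M : VonNeumannAlgebra H} {N : VonNeumannAlgebra K} (Φ : Elem M → Elem N) :
    Prop :=
  ∀ ψ : Elem N → ℂ, IsNormalFunctional N ψ → IsNormalFunctional M (fun m => ψ (Φ m))

/-- `ψ` is the tensor product `a ⊗ b` of the normal functionals `a` and `b`: it is the normal
functional on the von Neumann tensor product with `(a ⊗ b)(m ⊗ n) = a(m) b(n)`. -/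
def IsTensorFunctional {M : VonNeumannAlgebra H} {N : VonNeumannAlgebra K}
    (a : predual M) (b : predual N) (ψ : predual (vnTensor M N)) : Prop :=
  ∀ (m : Elem M) (n : Elem N), ψ.1 (elemTensor m n) = a.1 m * b.1 n

/-- Coassociativity `(Γ ⊗ ι) ∘ Γ = (ι ⊗ Γ) ∘ Γ`. Here `Γ ⊗ ι` and `ι ⊗ Γ` are the normal
⋆-homomorphisms determined by `m ⊗ n ↦ Γ(m) ⊗ n` and `m ⊗ n ↦ m ⊗ Γ(n)`; they take values in
`(M ⊗ M) ⊗ M` and `M ⊗ (M ⊗ M)`, which are identified through the canonical unitary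
`(ξ₁ ⊗ ξ₂) ⊗ ξ₃ ↦ ξ₁ ⊗ (ξ₂ ⊗ ξ₃)` of the underlying Hilbert spaces: two operators correspond
to each other exactly when their matrix coefficients at elementary tensors agree. -/
def Coassociative {M : VonNeumannAlgebra H} (Γ : Elem M →⋆ₐ[ℂ] Elem (vnTensor M M)) : Prop :=
  ∃ (Γι : Elem (vnTensor M M) →⋆ₐ[ℂ] Elem (vnTensor (vnTensor M M) M))
    (ιΓ : Elem (vnTensor M M) →⋆ₐ[ℂ] Elem (vnTensor M (vnTensor M M))),
    IsNormalMap Γι ∧ (∀ m n : Elem M, Γι (elemTensor m n) = elemTensor (Γ m) n) ∧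
    IsNormalMap ιΓ ∧ (∀ m n : Elem M, ιΓ (elemTensor m n) = elemTensor m (Γ n)) ∧
    ∀ (m : Elem M) (ξ₁ ξ₂ ξ₃ η₁ η₂ η₃ : H),
      ⟪vecTensor (vecTensor η₁ η₂) η₃,
        (Γι (Γ m)).1 (vecTensor (vecTensor ξ₁ ξ₂) ξ₃)⟫_ℂ =
      ⟪vecTensor η₁ (vecTensor η₂ η₃),
        (ιΓ (Γ m)).1 (vecTensor ξ₁ (vecTensor ξ₂ ξ₃))⟫_ℂ

end VonNeumann

/-- A Hopf–von Neumann algebra on the Hilbert space `H`: a von Neumann algebra `M` with an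
injective, normal, unital, coassociative ⋆-homomorphism `Γ : M → M ⊗ M`
(`→⋆ₐ` includes `Γ(1) = 1`, the unit of `M ⊗ M` being `1 ⊗ 1`). -/
structure HopfVonNeumannAlgebra (H : Type*) [NormedAddCommGroup H] [InnerProductSpace ℂ H]
    [CompleteSpace H] where
  /-- the underlying von Neumann algebra -/
  M : VonNeumannAlgebra H
  /-- the comultiplication -/
  Γ : Elem M →⋆ₐ[ℂ] Elem (vnTensor M M)
  injective : Function.Injective Γ
  normal : IsNormalMap Γ
  coassociative : Coassociative Γ

namespace HopfVonNeumannAlgebra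

variable {H : Type*} [NormedAddCommGroup H] [InnerProductSpace ℂ H] [CompleteSpace H]

/-- The intrinsic group: all invertible `x ∈ M` with `Γ(x) = x ⊗ x`. -/
def intrinsicGroup (𝓗 : HopfVonNeumannAlgebra H) : Subgroup (Elem 𝓗.M)ˣ where
  carrier := {x | 𝓗.Γ x = elemTensor (x : Elem 𝓗.M) (x : Elem 𝓗.M)}
  one_mem' := by
    apply Subtype.ext
    simp [elemTensor, opTensor_one]
  mul_mem' {x y} hx hy := by
    simp only [Set.mem_ofPred_eq] at hx hy ⊢
    rw [Units.val_mul, map_mul, hx, hy]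
    exact Subtype.ext (opTensor_mul _ _ _ _).symm
  inv_mem' {x} hx := by
    simp only [Set.mem_ofPred_eq] at hx ⊢
    have h1 : 𝓗.Γ (↑x⁻¹ : Elem 𝓗.M) * 𝓗.Γ x = 1 := by rw [← map_mul]; simp
    have h2 : elemTensor (x : Elem 𝓗.M) (x : Elem 𝓗.M) *
        elemTensor (↑x⁻¹ : Elem 𝓗.M) (↑x⁻¹ : Elem 𝓗.M) = 1 := by
      apply Subtype.ext
      change opTensor _ _ * opTensor _ _ = 1
      rw [← opTensor_mul]
      have : ((x : Elem 𝓗.M) : H →L[ℂ] H) * ((↑x⁻¹ : Elem 𝓗.M) : H →L[ℂ] H) = 1 :=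
        congrArg Subtype.val x.mul_inv
      rw [this, opTensor_one]
    rw [hx] at h1
    exact left_inv_eq_right_inv h1 h2

/-- The topology of the intrinsic group: the weak operator topology (on this group it coincides
with the ultraweak, the strong and the ultrastrong topology). -/
abbrev intrinsicTopology (𝓗 : HopfVonNeumannAlgebra H) : TopologicalSpace 𝓗.intrinsicGroup :=
  TopologicalSpace.induced
    (fun x => ContinuousLinearMapWOT.ofCLM (((x : (Elem 𝓗.M)ˣ) : Elem 𝓗.M) : H →L[ℂ] H))
    inferInstance

end HopfVonNeumannAlgebra

end HopfVN

end

/-! The decisive point is that the intrinsic group consists of unitaries. An injective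
⋆-homomorphism of C⋆-algebras is isometric, so `Γ x = x ⊗ x` gives `‖x ⊗ x‖ = ‖x‖`. Testing on `w ⊗
w` yields `‖x‖² ≤ ‖x‖`, hence `‖x‖ ≤ 1`. The same holds for the inverse, so `x` is a surjective
isometry. Conjugation by `x` is then a ⋆-automorphism, and it respects the product of the predual
because `Γ (x⁻¹ m x) = (x ⊗ x)⁻¹ Γ(m) (x ⊗ x)`.

A normal functional is a single vector functional `m ↦ ⟪η, (m ⊕ m ⊕ ⋯) ξ⟫` on an amplified space `L2
ι H`. Its norm is controlled by the vectors: if `‖φ‖ < c`, both can be chosen with squared norm at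
most `c` (`exists_ofVec_of_norm_lt`). This comes from Hahn–Banach and the fact that bounded
functionals on the predual are evaluations at elements of `M` (`exists_eval_eq`). Concatenating
representatives gives completeness, and tensoring them gives `‖a ⊗ b‖ ≤ ‖a‖ ‖b‖`. Uniqueness of `a ⊗
b` is the von Neumann density theorem. Associativity transports coassociativity through vector
representatives, where only matrix coefficients at elementary tensors occur.

For continuity, a unitary `u` sends the functional of `(ξ, η)` to that of `(u ξ, u η)`. Weak
convergence of unitaries gives norm convergence of these vectors, hence of the functionals. -/

noncomputable section

namespace HopfVN

/-! ### Amplifications to square summable families -/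

section Amplification

/-- The Hilbert space of square summable families of vectors of `H`. -/
abbrev L2 (ι H : Type*) [NormedAddCommGroup H] : Type _ := lp (fun _ : ι => H) 2

theorem memℓp_two_iff {ι H : Type*} [NormedAddCommGroup H] {f : ι → H} :
    Memℓp f 2 ↔ Summable fun i => ‖f i‖ ^ 2 := by
  rw [memℓp_gen_iff (by norm_num)]
  norm_num

theorem L2.hasSum_norm_sq {ι H : Type*} [NormedAddCommGroup H] (f : L2 ι H) :
    HasSum (fun i => ‖f i‖ ^ 2) (‖f‖ ^ 2) := by
  simpa using lp.hasSum_norm (p := 2) (by norm_num) f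

/-- Concatenation of a square summable family of square summable families. -/
def concat {ι κ H : Type*} [NormedAddCommGroup H] (ξ : κ → L2 ι H)
    (hξ : Summable fun k => ‖ξ k‖ ^ 2) : L2 (κ × ι) H :=
  ⟨fun p => ξ p.1 p.2, memℓp_two_iff.2 <|
    (summable_prod_of_nonneg fun _ => by positivity).2
      ⟨fun k => (L2.hasSum_norm_sq (ξ k)).summable, by
        simpa only [(L2.hasSum_norm_sq (ξ _)).tsum_eq] using hξ⟩⟩

theorem norm_concat_sq {ι κ H : Type*} [NormedAddCommGroup H] (ξ : κ → L2 ι H) (hξ) :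
    ‖concat ξ hξ‖ ^ 2 = ∑' k, ‖ξ k‖ ^ 2 := by
  have h := L2.hasSum_norm_sq (concat ξ hξ)
  exact (h.prod_fiberwise fun k => L2.hasSum_norm_sq (ξ k)).tsum_eq.symm

variable {ι κ H : Type*} [NormedAddCommGroup H] [InnerProductSpace ℂ H]

/-- The diagonal action of `T` on square summable families. -/
def amp (ι : Type*) (T : H →L[ℂ] H) : L2 ι H →L[ℂ] L2 ι H :=
  LinearMap.mkContinuous
    { toFun := fun f => ⟨fun i => T (f i), memℓp_two_iff.2 <|
        Summable.of_nonneg_of_le (fun _ => by positivity)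
          (fun i => by
            have := T.le_opNorm (f i)
            calc ‖T (f i)‖ ^ 2 ≤ (‖T‖ * ‖f i‖) ^ 2 := by gcongr
              _ = ‖T‖ ^ 2 * ‖f i‖ ^ 2 := by ring)
          ((L2.hasSum_norm_sq f).summable.mul_left _)⟩
      map_add' := fun f g => by ext i; exact map_add T _ _
      map_smul' := fun c f => by ext i; exact map_smul T c _ } ‖T‖ fun f => by
    refine lp.norm_le_of_tsum_le (by norm_num) (by positivity) ?_
    have h := (L2.hasSum_norm_sq f).mul_left (‖T‖ ^ 2)
    have h' : Summable fun i => ‖T (f i)‖ ^ 2 :=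
      Summable.of_nonneg_of_le (fun _ => by positivity)
        (fun i => by
          have := T.le_opNorm (f i)
          calc ‖T (f i)‖ ^ 2 ≤ (‖T‖ * ‖f i‖) ^ 2 := by gcongr
            _ = ‖T‖ ^ 2 * ‖f i‖ ^ 2 := by ring) h.summable
    have : ∑' i, ‖T (f i)‖ ^ 2 ≤ ‖T‖ ^ 2 * ‖f‖ ^ 2 := by
      rw [← h.tsum_eq]
      refine h'.tsum_le_tsum (fun i => ?_) h.summable
      have := T.le_opNorm (f i)
      calc ‖T (f i)‖ ^ 2 ≤ (‖T‖ * ‖f i‖) ^ 2 := by gcongr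
        _ = ‖T‖ ^ 2 * ‖f i‖ ^ 2 := by ring
    simpa [mul_pow] using this

@[simp] theorem amp_apply (T : H →L[ℂ] H) (f : L2 ι H) (i : ι) : amp ι T f i = T (f i) := rfl

theorem norm_amp_le (T : H →L[ℂ] H) : ‖amp ι T‖ ≤ ‖T‖ :=
  LinearMap.mkContinuous_norm_le _ (norm_nonneg _) _

theorem hasSum_inner_amp (T : H →L[ℂ] H) (ξ η : L2 ι H) :
    HasSum (fun i => ⟪η i, T (ξ i)⟫_ℂ) ⟪η, amp ι T ξ⟫_ℂ :=
  lp.hasSum_inner η (amp ι T ξ)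

theorem norm_inner_amp_le (T : H →L[ℂ] H) (ξ η : L2 ι H) :
    ‖⟪η, amp ι T ξ⟫_ℂ‖ ≤ ‖ξ‖ * ‖η‖ * ‖T‖ :=
  calc ‖⟪η, amp ι T ξ⟫_ℂ‖ ≤ ‖η‖ * ‖amp ι T ξ‖ := norm_inner_le_norm _ _
    _ ≤ ‖η‖ * (‖T‖ * ‖ξ‖) := by
        gcongr
        exact (ContinuousLinearMap.le_opNorm _ _).trans (by gcongr; exact norm_amp_le _)
    _ = ‖ξ‖ * ‖η‖ * ‖T‖ := by ring

theorem amp_single [DecidableEq ι] (T : H →L[ℂ] H) (i : ι) (v : H) :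
    amp ι T (lp.single 2 i v) = lp.single 2 i (T v) := by
  ext j
  by_cases h : j = i
  · subst h; simp
  · simp [h]

theorem hasSum_inner_concat (T : H →L[ℂ] H) (ξ η : κ → L2 ι H) (hξ hη) :
    HasSum (fun k => ⟪η k, amp ι T (ξ k)⟫_ℂ)
      ⟪concat η hη, amp (κ × ι) T (concat ξ hξ)⟫_ℂ :=
  (hasSum_inner_amp T (concat ξ hξ) (concat η hη)).prod_fiberwise
    fun k => hasSum_inner_amp T (ξ k) (η k)

/-- Extension by zero of a square summable family along an injective map. -/
def extendZero (f : ι → κ) (hf : Function.Injective f) (ξ : L2 ι H) : L2 κ H :=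
  ⟨Function.extend f ξ 0, memℓp_two_iff.2 <| by
    have : (fun k => ‖Function.extend f ξ 0 k‖ ^ 2) = Function.extend f (fun i => ‖ξ i‖ ^ 2) 0 := by
      funext k
      by_cases h : ∃ i, f i = k
      · obtain ⟨i, rfl⟩ := h
        simp [hf.extend_apply]
      · simp [Function.extend_apply' _ _ _ h]
    rw [this]
    exact (hasSum_extend_zero hf |>.2 (L2.hasSum_norm_sq ξ)).summable⟩

theorem inner_amp_extendZero (f : ι → κ) (hf : Function.Injective f) (T : H →L[ℂ] H)
    (ξ η : L2 ι H) :
    ⟪extendZero f hf η, amp κ T (extendZero f hf ξ)⟫_ℂ = ⟪η, amp ι T ξ⟫_ℂ := by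
  refine (hasSum_inner_amp T _ _).unique ?_
  have : (fun k => ⟪extendZero f hf η k, T (extendZero f hf ξ k)⟫_ℂ) =
      Function.extend f (fun i => ⟪η i, T (ξ i)⟫_ℂ) 0 := by
    funext k
    change ⟪Function.extend f η 0 k, T (Function.extend f ξ 0 k)⟫_ℂ = _
    by_cases h : ∃ i, f i = k
    · obtain ⟨i, rfl⟩ := h
      simp [hf.extend_apply]
    · simp [Function.extend_apply' _ _ _ h]
  rw [this]
  exact (hasSum_extend_zero hf).2 (hasSum_inner_amp T ξ η)

theorem norm_extendZero (f : ι → κ) (hf : Function.Injective f) (ξ : L2 ι H) :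
    ‖extendZero f hf ξ‖ = ‖ξ‖ := by
  have h : ⟪extendZero f hf ξ, extendZero f hf ξ⟫_ℂ = ⟪ξ, ξ⟫_ℂ :=
    inner_amp_extendZero f hf 1 ξ ξ
  rw [inner_self_eq_norm_sq_to_K, inner_self_eq_norm_sq_to_K] at h
  exact (sq_eq_sq₀ (by positivity) (by positivity)).1 (by exact_mod_cast h)

end Amplification

/-! ### Normal functionals as vector functionals of an amplification -/

section VectorFunctionals

variable {ι κ H : Type*} [NormedAddCommGroup H] [InnerProductSpace ℂ H] [CompleteSpace H]

scoped instance (M : VonNeumannAlgebra H) : NormedAddCommGroup (predual M) :=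
  (predual M).normedAddCommGroup

scoped instance (M : VonNeumannAlgebra H) : NormedSpace ℂ (predual M) :=
  (predual M).normedSpace

scoped instance (M : VonNeumannAlgebra H) : Module ℝ (predual M) :=
  Module.complexToReal _

theorem isNormalFunctional_inner_amp (M : VonNeumannAlgebra H) [Countable ι] (ξ η : L2 ι H) :
    IsNormalFunctional M fun m => ⟪η, amp ι (m : H →L[ℂ] H) ξ⟫_ℂ := by
  obtain ⟨f, hf⟩ := exists_injective_nat ι
  refine ⟨extendZero f hf ξ, extendZero f hf η, (L2.hasSum_norm_sq _).summable,
    (L2.hasSum_norm_sq _).summable, fun m => ?_⟩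
  have := hasSum_inner_amp (m : H →L[ℂ] H) (extendZero f hf ξ) (extendZero f hf η)
  rwa [inner_amp_extendZero] at this

/-- The normal functional `m ↦ ∑ᵢ ⟨m ξᵢ, ηᵢ⟩`. -/
def ofVec (M : VonNeumannAlgebra H) [Countable ι] (ξ η : L2 ι H) : predual M :=
  ⟨LinearMap.mkContinuous
    { toFun := fun m => ⟪η, amp ι (m : H →L[ℂ] H) ξ⟫_ℂ
      map_add' := fun m n => by
        rw [← inner_add_right]
        congr 1
      map_smul' := fun c m => by
        rw [RingHom.id_apply, smul_eq_mul, ← inner_smul_right]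
        congr 1 } (‖ξ‖ * ‖η‖) fun m => by
      exact norm_inner_amp_le (m : H →L[ℂ] H) ξ η,
    isNormalFunctional_inner_amp M ξ η⟩

theorem ofVec_apply (M : VonNeumannAlgebra H) [Countable ι] (ξ η : L2 ι H) (m : Elem M) :
    (ofVec M ξ η).1 m = ⟪η, amp ι (m : H →L[ℂ] H) ξ⟫_ℂ := rfl

theorem hasSum_ofVec (M : VonNeumannAlgebra H) [Countable ι] (ξ η : L2 ι H) (m : Elem M) :
    HasSum (fun i => ⟪η i, (m : H →L[ℂ] H) (ξ i)⟫_ℂ) ((ofVec M ξ η).1 m) :=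
  hasSum_inner_amp _ _ _

theorem norm_ofVec_le (M : VonNeumannAlgebra H) [Countable ι] (ξ η : L2 ι H) :
    ‖ofVec M ξ η‖ ≤ ‖ξ‖ * ‖η‖ :=
  ContinuousLinearMap.opNorm_le_bound _ (by positivity) fun m => norm_inner_amp_le m ξ η

theorem predual_ext {M : VonNeumannAlgebra H} {a b : predual M} (h : ∀ m, a.1 m = b.1 m) : a = b :=
  Subtype.ext (ContinuousLinearMap.ext h)

theorem IsNormalFunctional.exists_inner_amp {M : VonNeumannAlgebra H} {φ : Elem M → ℂ}
    (h : IsNormalFunctional M φ) :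
    ∃ ξ η : L2 ℕ H, ∀ m, φ m = ⟪η, amp ℕ (m : H →L[ℂ] H) ξ⟫_ℂ := by
  obtain ⟨ξ, η, hξ, hη, h⟩ := h
  exact ⟨⟨ξ, memℓp_two_iff.2 hξ⟩, ⟨η, memℓp_two_iff.2 hη⟩, fun m =>
    (h m).unique (hasSum_inner_amp _ _ _)⟩

theorem exists_eq_ofVec {M : VonNeumannAlgebra H} (a : predual M) :
    ∃ ξ η : L2 ℕ H, a = ofVec M ξ η := by
  obtain ⟨ξ, η, h⟩ := IsNormalFunctional.exists_inner_amp a.2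
  exact ⟨ξ, η, predual_ext h⟩

theorem ofVec_add_left (M : VonNeumannAlgebra H) [Countable ι] (ξ ξ' η : L2 ι H) :
    ofVec M (ξ + ξ') η = ofVec M ξ η + ofVec M ξ' η :=
  predual_ext fun m => by
    change ⟪η, amp ι (m : H →L[ℂ] H) (ξ + ξ')⟫_ℂ = (ofVec M ξ η).1 m + (ofVec M ξ' η).1 m
    rw [map_add, inner_add_right, ofVec_apply, ofVec_apply]

theorem ofVec_add_right (M : VonNeumannAlgebra H) [Countable ι] (ξ η η' : L2 ι H) :
    ofVec M ξ (η + η') = ofVec M ξ η + ofVec M ξ η' :=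
  predual_ext fun m => by
    change ⟪η + η', amp ι (m : H →L[ℂ] H) ξ⟫_ℂ = (ofVec M ξ η).1 m + (ofVec M ξ η').1 m
    rw [inner_add_left, ofVec_apply, ofVec_apply]

theorem ofVec_smul_left (M : VonNeumannAlgebra H) [Countable ι] (c : ℂ) (ξ η : L2 ι H) :
    ofVec M (c • ξ) η = c • ofVec M ξ η :=
  predual_ext fun m => by
    change ⟪η, amp ι (m : H →L[ℂ] H) (c • ξ)⟫_ℂ = c * (ofVec M ξ η).1 m
    rw [map_smul, inner_smul_right, ofVec_apply]

theorem ofVec_smul_right (M : VonNeumannAlgebra H) [Countable ι] (c : ℂ) (ξ η : L2 ι H) :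
    ofVec M ξ (c • η) = (starRingEnd ℂ c) • ofVec M ξ η :=
  predual_ext fun m => by
    change ⟪c • η, amp ι (m : H →L[ℂ] H) ξ⟫_ℂ = _ * (ofVec M ξ η).1 m
    rw [inner_smul_left, ofVec_apply]

/-- Concatenations and tensor products produce families indexed by `Bool × ℕ` or `ℕ × ℕ`; this
returns them to `ℕ` without changing norms. -/
theorem exists_ofVec_nat (M : VonNeumannAlgebra H) [Countable ι] (ξ η : L2 ι H) :
    ∃ ξ' η' : L2 ℕ H, ‖ξ'‖ = ‖ξ‖ ∧ ‖η'‖ = ‖η‖ ∧ ofVec M ξ' η' = ofVec M ξ η := by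
  obtain ⟨f, hf⟩ := exists_injective_nat ι
  exact ⟨_, _, norm_extendZero f hf ξ, norm_extendZero f hf η,
    predual_ext fun m => inner_amp_extendZero f hf _ _ _⟩

end VectorFunctionals

/-! ### Hahn–Banach separation through gauges -/

/-- The Hahn-Banach theorem for a seminorm on a complex vector space. -/
theorem exists_dual_of_seminorm {E : Type*} [AddCommGroup E] [Module ℂ E] (p : Seminorm ℂ E)
    (x : E) : ∃ f : E →ₗ[ℂ] ℂ, f x = p x ∧ ∀ y, ‖f y‖ ≤ p y := by
  let _ : SeminormedAddCommGroup E := p.toAddGroupSeminorm.toSeminormedAddCommGroup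
  let _ : NormedSpace ℂ E := ⟨fun a b => (map_smul_eq_mul p a b).le⟩
  obtain ⟨g, hg, hgx⟩ := exists_dual_vector'' ℂ x
  exact ⟨g.toLinearMap, hgx, fun y => (g.le_opNorm y).trans
    (mul_le_of_le_one_left (norm_nonneg y) hg)⟩

/-- A point at which every linear functional bounded by `1` on an absolutely convex absorbent set
takes a value of modulus less than `1` lies in that set. -/
theorem mem_of_forall_functional_lt_one {E : Type*} [AddCommGroup E] [Module ℝ E] [Module ℂ E]
    [IsScalarTower ℝ ℂ E] {s : Set E} (hs₀ : Balanced ℂ s) (hs₁ : Convex ℝ s)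
    (hs₂ : Absorbent ℝ s) (x : E)
    (h : ∀ F : E →ₗ[ℂ] ℂ, (∀ y ∈ s, ‖F y‖ ≤ 1) → ‖F x‖ < 1) : x ∈ s := by
  -- It suffices that the gauge of `s` is less than `1` at `x`. A functional dominated by the gauge
  -- and equal to it at `x` is bounded by `1` on `s`, so `h` applies to it.
  refine setOfPred_gauge_lt_one_subset_self hs₁ hs₂.zero_mem hs₂ ?_
  obtain ⟨F, hFx, hF⟩ := exists_dual_of_seminorm (gaugeSeminorm hs₀ hs₁ hs₂) x
  refine lt_of_le_of_lt ?_ (h F fun y hy => (hF y).trans (gauge_le_one_of_mem hy))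
  rw [hFx, Complex.norm_real]
  exact le_abs_self _

/-! ### Norm-controlled representatives and completeness of the predual -/

section UnitBall

variable {H : Type*} [NormedAddCommGroup H] [InnerProductSpace ℂ H] [CompleteSpace H]

/-- The normal functionals represented by square summable families in the unit ball. -/
def unitVec (M : VonNeumannAlgebra H) : Set (predual M) :=
  {φ | ∃ ξ η : L2 ℕ H, ‖ξ‖ ≤ 1 ∧ ‖η‖ ≤ 1 ∧ ofVec M ξ η = φ}

theorem ofVec_mem_unitVec (M : VonNeumannAlgebra H) {ι : Type*} [Countable ι] (ξ η : L2 ι H)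
    (h : ‖ξ‖ * ‖η‖ ≤ 1) : ofVec M ξ η ∈ unitVec M := by
  obtain ⟨ξ', η', h1, h2, h3⟩ := exists_ofVec_nat M ξ η
  rw [← h3]
  rw [← h1, ← h2] at h
  -- Only the product of the norms matters: `ξ'` is normalized and its length moved to `η'`.
  by_cases h0 : ‖ξ'‖ = 0
  · refine ⟨0, 0, by simp, by simp, ?_⟩
    rw [norm_eq_zero.1 h0, ← zero_smul ℂ (0 : L2 ℕ H), ofVec_smul_left, ofVec_smul_left, zero_smul,
      zero_smul]
  · refine ⟨(((‖ξ'‖⁻¹ : ℝ)) : ℂ) • ξ', ((‖ξ'‖ : ℝ) : ℂ) • η', ?_, ?_, ?_⟩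
    · rw [norm_smul, Complex.norm_real, norm_inv, norm_norm, inv_mul_cancel₀ h0]
    · rwa [norm_smul, Complex.norm_real, norm_norm]
    · rw [ofVec_smul_left, ofVec_smul_right, smul_smul, Complex.conj_ofReal, ← Complex.ofReal_mul,
        inv_mul_cancel₀ h0, Complex.ofReal_one, one_smul]

theorem balanced_unitVec (M : VonNeumannAlgebra H) : Balanced ℂ (unitVec M) := by
  rintro c hc _ ⟨_, ⟨ξ, η, hξ, hη, rfl⟩, rfl⟩
  refine ⟨c • ξ, η, ?_, hη, ofVec_smul_left _ _ _ _⟩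
  rw [norm_smul]
  exact mul_le_one₀ hc (norm_nonneg _) hξ

theorem convex_unitVec (M : VonNeumannAlgebra H) : Convex ℝ (unitVec M) := by
  rintro _ ⟨ξ, η, hξ, hη, rfl⟩ _ ⟨ξ', η', hξ', hη', rfl⟩ a b ha hb hab
  -- Square roots of the weights go on both families: the matrix coefficients then carry the weights
  -- `a` and `b`, while the squared norms become convex combinations.
  let s : Bool → ℂ := fun i => ((Real.sqrt (bif i then a else b) : ℝ) : ℂ)
  let f : Bool → L2 ℕ H := fun i => s i • bif i then ξ else ξ'
  let g : Bool → L2 ℕ H := fun i => s i • bif i then η else η'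
  have hf : Summable fun i => ‖f i‖ ^ 2 := (hasSum_fintype _).summable
  have hg : Summable fun i => ‖g i‖ ^ 2 := (hasSum_fintype _).summable
  have key (ζ ζ' : L2 ℕ H) (h : ‖ζ‖ ≤ 1) (h' : ‖ζ'‖ ≤ 1) :
      ∑ i, ‖s i • bif i then ζ else ζ'‖ ^ 2 ≤ 1 := by
    have h1 : ‖ζ‖ ^ 2 ≤ 1 := pow_le_one₀ (norm_nonneg _) h
    have h2 : ‖ζ'‖ ^ 2 ≤ 1 := pow_le_one₀ (norm_nonneg _) h'
    simp only [Fintype.sum_bool, s, norm_smul, mul_pow, Complex.norm_real, Real.norm_eq_abs,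
      sq_abs, cond_true, cond_false, Real.sq_sqrt ha, Real.sq_sqrt hb]
    nlinarith
  have e : a • ofVec M ξ η + b • ofVec M ξ' η' = ofVec M (concat f hf) (concat g hg) := by
    refine predual_ext fun m => ?_
    have h := (hasSum_inner_concat (m : H →L[ℂ] H) f g hf hg).unique (hasSum_fintype _)
    rw [ofVec_apply, h]
    change (a : ℂ) * (ofVec M ξ η).1 m + (b : ℂ) * (ofVec M ξ' η').1 m = _
    have hs (i) : s i * s i = ((bif i then a else b : ℝ) : ℂ) := by
      rw [← Complex.ofReal_mul, Real.mul_self_sqrt]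
      cases i <;> assumption
    have hs' (i) : starRingEnd ℂ (s i) = s i := Complex.conj_ofReal _
    simp only [Fintype.sum_bool, f, g, map_smul, inner_smul_left, inner_smul_right, ← mul_assoc,
      hs', hs, cond_true, cond_false, ofVec_apply]
  rw [e]
  refine ofVec_mem_unitVec M _ _ (mul_le_one₀ ?_ (norm_nonneg _) ?_)
  · refine (sq_le_one_iff₀ (norm_nonneg _)).1 ?_
    rw [norm_concat_sq, tsum_fintype]
    exact key _ _ hξ hξ'
  · refine (sq_le_one_iff₀ (norm_nonneg _)).1 ?_
    rw [norm_concat_sq, tsum_fintype]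
    exact key _ _ hη hη'

theorem absorbent_unitVec (M : VonNeumannAlgebra H) : Absorbent ℝ (unitVec M) := by
  intro φ
  obtain ⟨ξ, η, rfl⟩ := exists_eq_ofVec φ
  refine absorbs_iff_norm.2 ⟨‖ξ‖ * ‖η‖ + 1, fun c hc => ?_⟩
  have hc0 : 0 < ‖c‖ := lt_of_lt_of_le (by positivity) hc
  refine Set.singleton_subset_iff.2 ⟨ofVec M (((c⁻¹ : ℝ) : ℂ) • ξ) η, ?_, ?_⟩
  · refine ofVec_mem_unitVec M _ _ ?_
    rw [norm_smul, Complex.norm_real, norm_inv, mul_assoc, inv_mul_le_iff₀ hc0]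
    linarith
  · change ((c : ℝ) : ℂ) • ofVec M (((c⁻¹ : ℝ) : ℂ) • ξ) η = _
    rw [ofVec_smul_left, smul_smul, ← Complex.ofReal_mul, mul_inv_cancel₀ (norm_pos_iff.1 hc0),
      Complex.ofReal_one, one_smul]

theorem ofVec_single_eq_ofVec_single (M : VonNeumannAlgebra H) (i j : ℕ) (v w : H) :
    ofVec M (lp.single 2 i v : L2 ℕ H) (lp.single 2 i w) =
      ofVec M (lp.single 2 j v : L2 ℕ H) (lp.single 2 j w) :=
  predual_ext fun m => by
    simp only [ofVec_apply, amp_single, lp.inner_single_left, lp.single_apply_self]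

theorem ofVec_single_left (M : VonNeumannAlgebra H) (i : ℕ) (v : H) (η : L2 ℕ H) :
    ofVec M (lp.single 2 i v : L2 ℕ H) η =
      ofVec M (lp.single 2 i v : L2 ℕ H) (lp.single 2 i (η i)) :=
  predual_ext fun m => by
    simp only [ofVec_apply, amp_single, lp.inner_single_right, lp.single_apply_self]

theorem norm_apply_ofVec_le (M : VonNeumannAlgebra H) (F : predual M →ₗ[ℂ] ℂ)
    (hF : ∀ φ ∈ unitVec M, ‖F φ‖ ≤ 1) (ξ η : L2 ℕ H) : ‖F (ofVec M ξ η)‖ ≤ ‖ξ‖ * ‖η‖ := by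
  refine le_of_forall_pos_le_add fun ε hε => ?_
  -- The `ε` keeps the scaling factor invertible when one of the vectors is zero.
  set c := ‖ξ‖ * ‖η‖ + ε with hcdef
  have hc : 0 < c := by positivity
  have hmem : ofVec M (((c⁻¹ : ℝ) : ℂ) • ξ) η ∈ unitVec M := by
    refine ofVec_mem_unitVec M _ _ ?_
    rw [norm_smul, Complex.norm_real, norm_inv, Real.norm_of_nonneg hc.le, mul_assoc,
      inv_mul_le_iff₀ hc]
    linarith
  have := hF _ hmem
  rwa [ofVec_smul_left, map_smul, norm_smul, Complex.norm_real, norm_inv,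
    Real.norm_of_nonneg hc.le, inv_mul_le_iff₀ hc, mul_one] at this


theorem norm_apply_single_le (M : VonNeumannAlgebra H) (F : predual M →ₗ[ℂ] ℂ)
    (hF : ∀ φ ∈ unitVec M, ‖F φ‖ ≤ 1) (v w : H) :
    ‖F (ofVec M (lp.single 2 0 v : L2 ℕ H) (lp.single 2 0 w))‖ ≤ ‖v‖ * ‖w‖ := by
  refine (norm_apply_ofVec_le M F hF _ _).trans_eq ?_
  rw [lp.norm_single (by norm_num), lp.norm_single (by norm_num)]

/-- The operator whose matrix coefficients are the values of a linear functional on the predual. -/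
theorem exists_operator_of_functional (M : VonNeumannAlgebra H) (F : predual M →ₗ[ℂ] ℂ)
    (hF : ∀ φ ∈ unitVec M, ‖F φ‖ ≤ 1) : ∃ x : H →L[ℂ] H, ‖x‖ ≤ 1 ∧ ∀ v w,
      ⟪w, x v⟫_ℂ = F (ofVec M (lp.single 2 0 v : L2 ℕ H) (lp.single 2 0 w)) := by
  let B₀ : H →ₗ⋆[ℂ] H →ₗ[ℂ] ℂ := LinearMap.mk₂'ₛₗ (starRingEnd ℂ) (RingHom.id ℂ)
      (fun w v => F (ofVec M (lp.single 2 0 v : L2 ℕ H) (lp.single 2 0 w)))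
      (fun w w' v => by rw [lp.single_add, ofVec_add_right, map_add])
      (fun c w v => by rw [lp.single_smul, ofVec_smul_right, map_smul])
      (fun w v v' => by rw [lp.single_add, ofVec_add_left, map_add])
      (fun c w v => by rw [lp.single_smul, ofVec_smul_left, map_smul]; rfl)
  have hB₀ (w v : H) : ‖B₀ w v‖ ≤ 1 * ‖w‖ * ‖v‖ := by
    rw [one_mul, mul_comm]
    exact norm_apply_single_le M F hF v w
  let B : H →L⋆[ℂ] H →L[ℂ] ℂ := LinearMap.mkContinuous₂ B₀ 1 hB₀
  have hB (w v : H) : B w v = F (ofVec M (lp.single 2 0 v : L2 ℕ H) (lp.single 2 0 w)) := rfl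
  have hx (w v : H) :
      ⟪w, ContinuousLinearMap.adjoint (InnerProductSpace.continuousLinearMapOfBilin B) v⟫_ℂ =
        B w v := by
    rw [ContinuousLinearMap.adjoint_inner_right,
      InnerProductSpace.continuousLinearMapOfBilin_apply]
  refine ⟨_, ?_, fun v w => (hx w v).trans (hB w v)⟩
  refine ContinuousLinearMap.opNorm_le_bound _ zero_le_one fun v => ?_
  set y := ContinuousLinearMap.adjoint (InnerProductSpace.continuousLinearMapOfBilin B) v with hy
  -- Testing the form against `y` itself gives `‖y‖² ≤ ‖v‖ ‖y‖`.
  have h := norm_apply_single_le M F hF v y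
  rw [← hB, ← hx, ← hy, inner_self_eq_norm_sq_to_K] at h
  rw [one_mul]
  by_cases h0 : ‖y‖ = 0
  · rw [h0]; positivity
  · refine le_of_mul_le_mul_right (?_ : ‖y‖ * ‖y‖ ≤ ‖v‖ * ‖y‖) (by positivity)
    simpa [sq] using h

/-- The bound on `F` makes `ξ ↦ F (ofVec M ξ η)` continuous, so `F` may be applied termwise to the
expansion of `ξ` into its coordinates. Thus `F` is determined by rank-one vector functionals. -/
theorem hasSum_functional_ofVec_single (M : VonNeumannAlgebra H) (F : predual M →ₗ[ℂ] ℂ)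
    (hF : ∀ φ ∈ unitVec M, ‖F φ‖ ≤ 1) (ξ η : L2 ℕ H) :
    HasSum (fun i => F (ofVec M (lp.single 2 0 (ξ i) : L2 ℕ H) (lp.single 2 0 (η i))))
      (F (ofVec M ξ η)) := by
  let G₀ : L2 ℕ H →ₗ[ℂ] ℂ :=
    { toFun := fun ξ => F (ofVec M ξ η)
      map_add' := fun ξ ξ' => by rw [ofVec_add_left, map_add]
      map_smul' := fun c ξ => by rw [ofVec_smul_left, map_smul]; rfl }
  have hG₀ (ξ) : ‖G₀ ξ‖ ≤ ‖η‖ * ‖ξ‖ :=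
    (norm_apply_ofVec_le M F hF ξ η).trans_eq (mul_comm _ _)
  have := (lp.hasSum_single (by norm_num) ξ).mapL (G₀.mkContinuous _ hG₀)
  refine this.congr_fun fun i => ?_
  change _ = F (ofVec M (lp.single 2 i (ξ i)) η)
  rw [ofVec_single_eq_ofVec_single M 0 i, ← ofVec_single_left]

/-- A linear functional on the predual bounded by `1` on `unitVec M` is the evaluation at an
element of the unit ball of `M`. -/
theorem exists_eval_eq (M : VonNeumannAlgebra H) (F : predual M →ₗ[ℂ] ℂ)
    (hF : ∀ φ ∈ unitVec M, ‖F φ‖ ≤ 1) : ∃ m : Elem M, ‖m‖ ≤ 1 ∧ ∀ φ : predual M, F φ = φ.1 m := by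
  obtain ⟨x, hxn, hx⟩ := exists_operator_of_functional M F hF
  have hxM : x ∈ M := by
    -- By the double commutant theorem it is enough that `x` commutes with every `t` in the
    -- commutant. The functionals of `(v, t⋆ w)` and `(t v, w)` agree on `M`, so `F` takes the same
    -- value on both.
    rw [← VonNeumannAlgebra.commutant_commutant M, VonNeumannAlgebra.mem_commutant_iff]
    intro t ht
    refine ContinuousLinearMap.ext fun v => ext_inner_left ℂ fun w => ?_
    change ⟪w, t (x v)⟫_ℂ = ⟪w, x (t v)⟫_ℂ
    rw [← ContinuousLinearMap.adjoint_inner_left, hx, hx]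
    congr 1
    refine predual_ext fun m => ?_
    simp only [ofVec_apply, amp_single, lp.inner_single_left, lp.single_apply_self,
      ContinuousLinearMap.adjoint_inner_left]
    have := VonNeumannAlgebra.mem_commutant_iff.1 ht m m.2
    exact congrArg (fun T : H →L[ℂ] H => ⟪w, T v⟫_ℂ) this.symm
  refine ⟨⟨x, hxM⟩, hxn, fun φ => ?_⟩
  obtain ⟨ξ, η, rfl⟩ := exists_eq_ofVec φ
  refine (hasSum_functional_ofVec_single M F hF ξ η).unique ?_
  exact (hasSum_ofVec M ξ η _).congr_fun fun i => (hx _ _).symm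

/-- A normal functional of norm less than `1` is represented by families in the unit ball. -/
theorem mem_unitVec_of_norm_lt_one {M : VonNeumannAlgebra H} (φ : predual M) (h : ‖φ‖ < 1) :
    φ ∈ unitVec M := by
  refine mem_of_forall_functional_lt_one (balanced_unitVec M) (convex_unitVec M)
    (absorbent_unitVec M) φ fun F hF => ?_
  obtain ⟨m, hm, hFm⟩ := exists_eval_eq M F hF
  rw [hFm]
  exact ((φ.1.le_opNorm m).trans (mul_le_of_le_one_right (norm_nonneg _) hm)).trans_lt h

theorem exists_ofVec_of_norm_lt {M : VonNeumannAlgebra H} (φ : predual M) {c : ℝ} (h : ‖φ‖ < c) :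
    ∃ ξ η : L2 ℕ H, ‖ξ‖ ^ 2 ≤ c ∧ ‖η‖ ^ 2 ≤ c ∧ φ = ofVec M ξ η := by
  have hc : 0 < c := (norm_nonneg φ).trans_lt h
  obtain ⟨ξ, η, hξ, hη, e⟩ := mem_unitVec_of_norm_lt_one (((c⁻¹ : ℝ) : ℂ) • φ) (by
    rw [norm_smul, Complex.norm_real, norm_inv, Real.norm_of_nonneg hc.le, inv_mul_lt_iff₀ hc]
    simpa using h)
  have key (ζ : L2 ℕ H) (hζ : ‖ζ‖ ≤ 1) : ‖((Real.sqrt c : ℝ) : ℂ) • ζ‖ ^ 2 ≤ c := by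
    rw [norm_smul, Complex.norm_real, mul_pow, Real.norm_eq_abs, sq_abs, Real.sq_sqrt hc.le]
    exact mul_le_of_le_one_right hc.le (pow_le_one₀ (norm_nonneg _) hζ)
  refine ⟨_, _, key ξ hξ, key η hη, ?_⟩
  rw [ofVec_smul_left, ofVec_smul_right, e, smul_smul, smul_smul, Complex.conj_ofReal,
    ← Complex.ofReal_mul, ← Complex.ofReal_mul, Real.mul_self_sqrt hc.le, mul_inv_cancel₀ hc.ne',
    Complex.ofReal_one, one_smul]

/-- An absolutely convergent series of functionals is summed by concatenating representatives, whose
squared norms are summable; the limit is thus again normal. -/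
theorem completeSpace_predual (M : VonNeumannAlgebra H) : CompleteSpace (predual M) := by
  refine NormedAddCommGroup.completeSpace_of_summable_imp_tendsto (E := predual M) fun u hu => ?_
  -- The summable margin `(1/2)^n` supplies the strict bound needed to choose representatives.
  have hgeo : Summable fun n : ℕ => ‖u n‖ + (1 / 2 : ℝ) ^ n :=
    hu.add summable_geometric_two
  choose ξ η hξ hη he using fun n => exists_ofVec_of_norm_lt (u n)
    (lt_add_of_pos_right ‖u n‖ (show (0 : ℝ) < (1 / 2) ^ n by positivity))
  have sξ : Summable fun n => ‖ξ n‖ ^ 2 := hgeo.of_nonneg_of_le (fun _ => by positivity) hξ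
  have sη : Summable fun n => ‖η n‖ ^ 2 := hgeo.of_nonneg_of_le (fun _ => by positivity) hη
  refine ⟨ofVec M (concat ξ sξ) (concat η sη), ?_⟩
  have hs : Summable fun n => (u n).1 := Summable.of_norm hu
  have hlim : ∑' n, (u n).1 = (ofVec M (concat ξ sξ) (concat η sη)).1 := by
    refine ContinuousLinearMap.ext fun m => ?_
    have h1 := hs.hasSum.mapL (ContinuousLinearMap.apply ℂ ℂ m)
    refine h1.unique ?_
    refine (hasSum_inner_concat (m : H →L[ℂ] H) ξ η sξ sη).congr_fun fun n => ?_
    rw [he n]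
    rfl
  rw [tendsto_subtype_rng, ← hlim]
  simpa using hs.hasSum.tendsto_sum_nat

end UnitBall

/-! ### The density theorem -/

/-- An operator on `L2 ι H` commutes with `amp ι T` when its matrix entries commute with `T`. -/
theorem commute_amp {ι H : Type*} [NormedAddCommGroup H] [InnerProductSpace ℂ H] [DecidableEq ι]
    (P : L2 ι H →L[ℂ] L2 ι H) (T : H →L[ℂ] H)
    (h : ∀ i j v, T (P (lp.single 2 j v) i) = P (lp.single 2 j (T v)) i) :
    amp ι T ∘L P = P ∘L amp ι T := by
  refine lp.ext_continuousLinearMap (by norm_num) fun j => ContinuousLinearMap.ext fun v => ?_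
  change amp ι T (P (lp.single 2 j v)) = P (amp ι T (lp.single 2 j v))
  rw [amp_single]
  exact lp.ext (funext fun i => h i j v)

section Density

variable {ι H : Type*} [NormedAddCommGroup H] [InnerProductSpace ℂ H] [CompleteSpace H]

theorem adjoint_amp (T : H →L[ℂ] H) :
    ContinuousLinearMap.adjoint (amp ι T) = amp ι (ContinuousLinearMap.adjoint T) := by
  refine ((ContinuousLinearMap.eq_adjoint_iff _ _).2 fun x y => ?_).symm
  refine (lp.hasSum_inner (amp ι (ContinuousLinearMap.adjoint T) x) y).unique ?_
  refine (lp.hasSum_inner x (amp ι T y)).congr_fun fun i => ?_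
  simp [ContinuousLinearMap.adjoint_inner_left]

/-- The von Neumann density theorem: a normal functional that vanishes on a self-adjoint monoid
of operators vanishes on the von Neumann algebra generated by it. -/
theorem inner_amp_eq_zero_of_mem_generated [DecidableEq ι] {S : Set (H →L[ℂ] H)}
    (hone : 1 ∈ S) (hmul : ∀ a ∈ S, ∀ b ∈ S, a * b ∈ S) (hstar : ∀ a ∈ S, star a ∈ S)
    (ξ η : L2 ι H) (h : ∀ a ∈ S, ⟪η, amp ι a ξ⟫_ℂ = 0) {T : H →L[ℂ] H} (hT : T ∈ generated S) :
    ⟪η, amp ι T ξ⟫_ℂ = 0 := by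
  -- The projection `P` onto the closed cyclic subspace `E` generated by `ξ` commutes with the
  -- amplification of `S`, so its matrix entries commute with `S` and hence with `T`. Therefore `amp
  -- ι T ξ` stays in `E`, which is orthogonal to `η`.
  let V : Submodule ℂ (L2 ι H) := Submodule.span ℂ {u | ∃ a ∈ S, u = amp ι a ξ}
  let E : Submodule ℂ (L2 ι H) := V.topologicalClosure
  have hξE : ξ ∈ E := V.le_topologicalClosure (Submodule.subset_span ⟨1, hone, rfl⟩)
  have hinv (a) (ha : a ∈ S) : E ∈ Module.End.invtSubmodule (amp ι a).toLinearMap := by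
    rw [Module.End.mem_invtSubmodule_iff_forall_mem_of_mem]
    intro u hu
    refine map_mem_closure (s := V) (t := V) (amp ι a).continuous hu fun w hw => ?_
    have : V ≤ V.comap (amp ι a).toLinearMap := by
      refine Submodule.span_le.2 ?_
      rintro _ ⟨b, hb, rfl⟩
      exact Submodule.subset_span ⟨a * b, hmul a ha b hb, rfl⟩
    exact this hw
  let P := E.starProjection
  have hcomm (a) (ha : a ∈ S) (u) : P (amp ι a u) = amp ι a (P u) := by
    have h1 := (ContinuousLinearMap.IsIdempotentElem.commute_iff (T := amp ι a)
      E.isIdempotentElem_starProjection).2 ⟨by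
        rw [Submodule.range_starProjection]; exact hinv a ha, by
        rw [Submodule.ker_starProjection]
        refine ContinuousLinearMap.orthogonal_mem_invtSubmodule ?_
        rw [adjoint_amp]
        exact hinv _ (hstar a ha)⟩
    exact congrArg (fun f : L2 ι H →L[ℂ] L2 ι H => f u) h1.eq
  have hTP : amp ι T ∘L P = P ∘L amp ι T := by
    refine commute_amp P T fun i j v => ?_
    let Q : H →L[ℂ] H := lp.evalCLM ℂ (fun _ : ι => H) 2 i ∘L P ∘L
      lp.singleContinuousLinearMap ℂ (fun _ : ι => H) 2 j
    have hQ (v) : Q v = P (lp.single 2 j v) i := rfl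
    have hQa (a) (ha : a ∈ S) : a * Q = Q * a := by
      refine ContinuousLinearMap.ext fun v => ?_
      change a (Q v) = Q (a v)
      rw [hQ, hQ, ← amp_single, hcomm a ha, amp_apply]
    have hQS : Q ∈ StarSubalgebra.centralizer ℂ S :=
      StarSubalgebra.mem_centralizer_iff ℂ |>.2 fun a ha => ⟨hQa a ha, hQa _ (hstar a ha)⟩
    have := ((StarSubalgebra.mem_centralizer_iff ℂ).1 hT Q hQS).1
    exact (congrArg (fun f : H →L[ℂ] H => f v) this).symm
  have hmem : amp ι T ξ ∈ E := by
    have : amp ι T (P ξ) = P (amp ι T ξ) := congrArg (fun f : L2 ι H →L[ℂ] L2 ι H => f ξ) hTP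
    rw [Submodule.starProjection_eq_self_iff.2 hξE] at this
    exact Submodule.starProjection_eq_self_iff.1 this.symm
  have hV : V ≤ LinearMap.ker (innerSL ℂ η).toLinearMap := by
    refine Submodule.span_le.2 ?_
    rintro _ ⟨a, ha, rfl⟩
    exact h a ha
  exact Submodule.topologicalClosure_minimal V hV (innerSL ℂ η).isClosed_ker hmem

end Density

/-! ### Tensor products of operators and of normal functionals -/

section Tensor

variable {ι κ H K : Type*} [NormedAddCommGroup H] [InnerProductSpace ℂ H]
  [NormedAddCommGroup K] [InnerProductSpace ℂ K]

theorem inner_vecTensor (ξ ξ' : H) (η η' : K) :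
    ⟪vecTensor ξ η, vecTensor ξ' η'⟫_ℂ = ⟪ξ, ξ'⟫_ℂ * ⟪η, η'⟫_ℂ := by
  rw [vecTensor, vecTensor, UniformSpace.Completion.inner_coe, TensorProduct.inner_tmul]

theorem norm_vecTensor (ξ : H) (η : K) : ‖vecTensor ξ η‖ = ‖ξ‖ * ‖η‖ := by
  rw [vecTensor, UniformSpace.Completion.norm_coe, TensorProduct.norm_tmul]

theorem norm_mul_norm_le_opTensor (S : H →L[ℂ] H) (T : K →L[ℂ] K) (ξ : H) (η : K) :
    ‖S ξ‖ * ‖T η‖ ≤ ‖opTensor S T‖ * (‖ξ‖ * ‖η‖) := by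
  rw [← norm_vecTensor, ← norm_vecTensor, ← opTensor_vecTensor]
  exact ContinuousLinearMap.le_opNorm _ _

theorem star_opTensor [CompleteSpace H] [CompleteSpace K] (S : H →L[ℂ] H) (T : K →L[ℂ] K) :
    star (opTensor S T) = opTensor (star S) (star T) := by
  refine ((ContinuousLinearMap.eq_adjoint_iff _ _).2 fun x y => ?_).symm
  refine UniformSpace.Completion.induction_on₂ x y
    (isClosed_eq (by fun_prop) (by fun_prop)) fun x y => ?_
  simp only [opTensor, ContinuousLinearMap.completion_apply_coe, UniformSpace.Completion.inner_coe,
    TensorProduct.mapL_apply]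
  induction x with
  | zero => simp
  | add x x' hx hx' => simp only [map_add, inner_add_left, hx, hx']
  | tmul x x' =>
    induction y with
    | zero => simp
    | add y y' hy hy' => simp only [map_add, inner_add_right, hy, hy']
    | tmul y y' =>
      simp [TensorProduct.inner_tmul, ContinuousLinearMap.star_eq_adjoint,
        ContinuousLinearMap.adjoint_inner_left]

/-- The tensor product of two square summable families. -/
def tensorFamily (ξ : L2 ι H) (η : L2 κ K) : L2 (ι × κ) (HilbertTensor H K) :=
  ⟨fun p => vecTensor (ξ p.1) (η p.2), memℓp_two_iff.2 <| by
    simp only [norm_vecTensor, mul_pow]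
    exact (L2.hasSum_norm_sq ξ).summable.mul_of_nonneg (L2.hasSum_norm_sq η).summable
      (fun _ => by positivity) (fun _ => by positivity)⟩

@[simp] theorem tensorFamily_apply (ξ : L2 ι H) (η : L2 κ K) (p : ι × κ) :
    tensorFamily ξ η p = vecTensor (ξ p.1) (η p.2) := rfl

theorem norm_tensorFamily (ξ : L2 ι H) (η : L2 κ K) : ‖tensorFamily ξ η‖ = ‖ξ‖ * ‖η‖ := by
  refine (sq_eq_sq₀ (by positivity) (by positivity)).1 ?_
  rw [mul_pow]
  refine ((L2.hasSum_norm_sq (tensorFamily ξ η)).prod_fiberwise fun i => ?_).unique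
    ((L2.hasSum_norm_sq ξ).mul_right _)
  simp only [tensorFamily_apply, norm_vecTensor, mul_pow]
  exact (L2.hasSum_norm_sq η).mul_left _

variable [CompleteSpace H] [CompleteSpace K]

/-- A normal functional on a von Neumann tensor product is determined by its values on the
elementary tensors. -/
theorem predual_vnTensor_ext {M : VonNeumannAlgebra H} {N : VonNeumannAlgebra K}
    {φ ψ : predual (vnTensor M N)}
    (h : ∀ m n, φ.1 (elemTensor m n) = ψ.1 (elemTensor (M := M) (N := N) m n)) : φ = ψ := by
  obtain ⟨ξ, η, e⟩ := exists_eq_ofVec (φ - ψ)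
  refine sub_eq_zero.1 ?_
  rw [e]
  refine predual_ext fun m => ?_
  -- The elementary tensors already form a self-adjoint monoid, so the density theorem applies to
  -- them without passing to their linear span.
  refine inner_amp_eq_zero_of_mem_generated
    (S := {T | ∃ m ∈ M, ∃ n ∈ N, T = opTensor m n}) ?_ ?_ ?_ ξ η ?_ m.2
  · exact ⟨1, one_mem M, 1, one_mem N, opTensor_one.symm⟩
  · rintro _ ⟨m, hm, n, hn, rfl⟩ _ ⟨m', hm', n', hn', rfl⟩
    exact ⟨m * m', mul_mem hm hm', n * n', mul_mem hn hn', (opTensor_mul _ _ _ _).symm⟩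
  · rintro _ ⟨m, hm, n, hn, rfl⟩
    exact ⟨star m, star_mem hm, star n, star_mem hn, star_opTensor m n⟩
  · rintro _ ⟨m, hm, n, hn, rfl⟩
    have h1 : (ofVec (vnTensor M N) ξ η).1 (elemTensor ⟨m, hm⟩ ⟨n, hn⟩) = 0 := by
      rw [← e]
      exact sub_eq_zero.2 (h ⟨m, hm⟩ ⟨n, hn⟩)
    exact h1

theorem ofVec_tensorFamily_apply (M : VonNeumannAlgebra H) (N : VonNeumannAlgebra K)
    [Countable ι] [Countable κ] (ξ η : L2 ι H) (ξ' η' : L2 κ K) :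
    IsTensorFunctional (ofVec M ξ η) (ofVec N ξ' η')
      (ofVec (vnTensor M N) (tensorFamily ξ ξ') (tensorFamily η η')) := by
  intro m n
  refine ((hasSum_ofVec (vnTensor M N) (tensorFamily ξ ξ') (tensorFamily η η')
    (elemTensor m n)).prod_fiberwise fun i => ?_).unique ((hasSum_ofVec M ξ η m).mul_right _)
  refine ((hasSum_ofVec N ξ' η' n).mul_left _).congr_fun fun k => ?_
  simp only [tensorFamily_apply, elemTensor, opTensor_vecTensor, inner_vecTensor]

theorem existsUnique_isTensorFunctional {M : VonNeumannAlgebra H} {N : VonNeumannAlgebra K}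
    (a : predual M) (b : predual N) :
    ∃! ψ : predual (vnTensor M N), IsTensorFunctional a b ψ := by
  obtain ⟨ξ, η, rfl⟩ := exists_eq_ofVec a
  obtain ⟨ξ', η', rfl⟩ := exists_eq_ofVec b
  have h := ofVec_tensorFamily_apply M N ξ η ξ' η'
  exact ⟨_, h, fun ψ hψ => predual_vnTensor_ext fun m n => (hψ m n).trans (h m n).symm⟩

/-- The tensor product of two normal functionals. -/
def tensorFunctional {M : VonNeumannAlgebra H} {N : VonNeumannAlgebra K}
    (a : predual M) (b : predual N) : predual (vnTensor M N) :=
  (existsUnique_isTensorFunctional a b).choose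

theorem isTensorFunctional_tensorFunctional {M : VonNeumannAlgebra H} {N : VonNeumannAlgebra K}
    (a : predual M) (b : predual N) : IsTensorFunctional a b (tensorFunctional a b) :=
  (existsUnique_isTensorFunctional a b).choose_spec.1

theorem IsTensorFunctional.eq_tensorFunctional {M : VonNeumannAlgebra H} {N : VonNeumannAlgebra K}
    {a : predual M} {b : predual N} {ψ : predual (vnTensor M N)} (h : IsTensorFunctional a b ψ) :
    ψ = tensorFunctional a b :=
  (existsUnique_isTensorFunctional a b).choose_spec.2 ψ h

theorem tensorFunctional_ofVec (M : VonNeumannAlgebra H) (N : VonNeumannAlgebra K)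
    [Countable ι] [Countable κ] (ξ η : L2 ι H) (ξ' η' : L2 κ K) :
    tensorFunctional (ofVec M ξ η) (ofVec N ξ' η') =
      ofVec (vnTensor M N) (tensorFamily ξ ξ') (tensorFamily η η') :=
  (ofVec_tensorFamily_apply M N ξ η ξ' η').eq_tensorFunctional.symm

theorem norm_tensorFunctional_le {M : VonNeumannAlgebra H} {N : VonNeumannAlgebra K}
    (a : predual M) (b : predual N) : ‖tensorFunctional a b‖ ≤ ‖a‖ * ‖b‖ := by
  have key (c d : ℝ) (hc : ‖a‖ < c) (hd : ‖b‖ < d) : ‖tensorFunctional a b‖ ≤ c * d := by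
    obtain ⟨ξ, η, hξ, hη, rfl⟩ := exists_ofVec_of_norm_lt a hc
    obtain ⟨ξ', η', hξ', hη', rfl⟩ := exists_ofVec_of_norm_lt b hd
    have hc0 : 0 ≤ c := (norm_nonneg (ofVec M ξ η)).trans hc.le
    have hd0 : 0 ≤ d := (norm_nonneg (ofVec N ξ' η')).trans hd.le
    rw [tensorFunctional_ofVec]
    refine (norm_ofVec_le _ _ _).trans ?_
    rw [norm_tensorFamily, norm_tensorFamily]
    have h1 : ‖ξ‖ * ‖η‖ ≤ c := by nlinarith [sq_nonneg (‖ξ‖ - ‖η‖)]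
    have h2 : ‖ξ'‖ * ‖η'‖ ≤ d := by nlinarith [sq_nonneg (‖ξ'‖ - ‖η'‖)]
    calc ‖ξ‖ * ‖ξ'‖ * (‖η‖ * ‖η'‖) = (‖ξ‖ * ‖η‖) * (‖ξ'‖ * ‖η'‖) := by ring
      _ ≤ c * d := by gcongr
  -- Representatives exist only for bounds strictly above the norms, so the sharp estimate is a
  -- limit as `ε → 0`.
  refine ge_of_tendsto (x := 𝓝[>] (0 : ℝ)) (f := fun ε => (‖a‖ + ε) * (‖b‖ + ε)) ?_ ?_
  · have : Continuous fun ε : ℝ => (‖a‖ + ε) * (‖b‖ + ε) := by fun_prop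
    simpa using (this.tendsto 0).mono_left nhdsWithin_le_nhds
  · filter_upwards [self_mem_nhdsWithin] with ε hε
    exact key _ _ (lt_add_of_pos_right _ hε) (lt_add_of_pos_right _ hε)

end Tensor

/-! ### Pre-adjoints of normal homomorphisms -/

section Composition

variable {H K : Type*} [NormedAddCommGroup H] [InnerProductSpace ℂ H] [CompleteSpace H]
  [NormedAddCommGroup K] [InnerProductSpace ℂ K] [CompleteSpace K]

/-- Norm closedness makes `M` a C⋆-algebra, so that ⋆-homomorphisms are contractive, and isometric
when injective. -/
theorem isClosed_vonNeumannAlgebra (M : VonNeumannAlgebra H) :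
    IsClosed (M.toStarSubalgebra : Set (H →L[ℂ] H)) := by
  have := Set.isClosed_centralizer (Set.centralizer (M : Set (H →L[ℂ] H)))
  rwa [VonNeumannAlgebra.centralizer_centralizer] at this

theorem norm_starAlgHom_apply_le {M : VonNeumannAlgebra H} {N : VonNeumannAlgebra K}
    (Φ : Elem M →⋆ₐ[ℂ] Elem N) (m : Elem M) : ‖Φ m‖ ≤ ‖m‖ := by
  have := isClosed_vonNeumannAlgebra M
  have := isClosed_vonNeumannAlgebra N
  exact NonUnitalStarAlgHom.norm_apply_le Φ m

theorem norm_starAlgHom_apply {M : VonNeumannAlgebra H} {N : VonNeumannAlgebra K}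
    (Φ : Elem M →⋆ₐ[ℂ] Elem N) (hΦ : Function.Injective Φ) (m : Elem M) : ‖Φ m‖ = ‖m‖ := by
  have := isClosed_vonNeumannAlgebra M
  have := isClosed_vonNeumannAlgebra N
  exact NonUnitalStarAlgHom.norm_map Φ hΦ m

/-- The pre-adjoint of a normal homomorphism. -/
def predualComp {M : VonNeumannAlgebra H} {N : VonNeumannAlgebra K}
    (Φ : Elem M →⋆ₐ[ℂ] Elem N) (hΦ : IsNormalMap Φ) : predual N →ₗ[ℂ] predual M where
  toFun ψ := ⟨ψ.1 ∘L LinearMap.mkContinuous Φ.toLinearMap 1 fun m => by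
    rw [one_mul]
    exact norm_starAlgHom_apply_le Φ m, hΦ _ ψ.2⟩
  map_add' _ _ := rfl
  map_smul' _ _ := rfl

theorem predualComp_apply {M : VonNeumannAlgebra H} {N : VonNeumannAlgebra K}
    (Φ : Elem M →⋆ₐ[ℂ] Elem N) (hΦ : IsNormalMap Φ) (ψ : predual N) (m : Elem M) :
    (predualComp Φ hΦ ψ).1 m = ψ.1 (Φ m) := rfl

theorem norm_predualComp_le {M : VonNeumannAlgebra H} {N : VonNeumannAlgebra K}
    (Φ : Elem M →⋆ₐ[ℂ] Elem N) (hΦ : IsNormalMap Φ) (ψ : predual N) :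
    ‖predualComp Φ hΦ ψ‖ ≤ ‖ψ‖ := by
  refine ContinuousLinearMap.opNorm_le_bound _ (norm_nonneg ψ) fun m => ?_
  refine (ψ.1.le_opNorm (Φ m)).trans ?_
  exact mul_le_mul_of_nonneg_left (norm_starAlgHom_apply_le Φ m) (norm_nonneg ψ)

end Composition

/-! ### Conjugation by unitaries and its continuity on the predual -/

section Conjugation

variable {ι H : Type*} [NormedAddCommGroup H] [InnerProductSpace ℂ H] [CompleteSpace H]
  {M : VonNeumannAlgebra H}

theorem inner_amp_star_mul_mul (u m : H →L[ℂ] H) (ξ η : L2 ι H) :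
    ⟪η, amp ι (star u * m * u) ξ⟫_ℂ = ⟪amp ι u η, amp ι m (amp ι u ξ)⟫_ℂ := by
  rw [← ContinuousLinearMap.adjoint_inner_right, adjoint_amp]
  rfl

theorem isNormalMap_conj (u : unitary (Elem M)) :
    IsNormalMap (Unitary.conjStarAlgAut ℂ (Elem M) (star u)) := by
  intro ψ hψ
  obtain ⟨ξ, η, h⟩ := hψ.exists_inner_amp
  have : (fun m => ψ (Unitary.conjStarAlgAut ℂ (Elem M) (star u) m)) = fun m : Elem M =>
      ⟪amp ℕ (u : Elem M).1 η, amp ℕ (m : H →L[ℂ] H) (amp ℕ (u : Elem M).1 ξ)⟫_ℂ := by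
    funext m
    rw [h, Unitary.conjStarAlgAut_star_apply, ← inner_amp_star_mul_mul]
    rfl
  rw [this]
  exact isNormalFunctional_inner_amp M _ _

/-- The linear map `a ↦ a(u⁻¹ · u)` of the predual given by a unitary `u`. -/
def predualConjAux (u : unitary (Elem M)) : predual M →ₗ[ℂ] predual M :=
  predualComp (Unitary.conjStarAlgAut ℂ (Elem M) (star u) : Elem M →⋆ₐ[ℂ] Elem M)
    (isNormalMap_conj u)

theorem norm_predualConjAux_le (u : unitary (Elem M)) (a : predual M) :
    ‖predualConjAux u a‖ ≤ ‖a‖ :=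
  norm_predualComp_le _ (isNormalMap_conj u) a

/-- The isometry `a ↦ a(u⁻¹ · u)` of the predual given by a unitary `u`. -/
def predualConj (u : unitary (Elem M)) : predual M ≃ₗᵢ[ℂ] predual M :=
  have hf (u v : unitary (Elem M)) (h : u * v = 1) (a : predual M) :
      predualConjAux u (predualConjAux v a) = a :=
    predual_ext fun m => by
      change a.1 (Unitary.conjStarAlgAut ℂ (Elem M) (star v)
        (Unitary.conjStarAlgAut ℂ (Elem M) (star u) m)) = _
      rw [← Unitary.conjStarAlgAut_mul_apply, ← star_mul, h, star_one, map_one]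
      rfl
  have h1 : u * star u = 1 := Unitary.mul_star_self u
  have h2 : star u * u = 1 := Unitary.star_mul_self u
  { toFun := predualConjAux u
    map_add' := map_add _
    map_smul' := map_smul _
    invFun := predualConjAux (star u)
    left_inv := hf _ _ h2
    right_inv := hf _ _ h1
    norm_map' := fun a => by
      refine le_antisymm (norm_predualConjAux_le u a) ?_
      calc ‖a‖ = ‖predualConjAux (star u) (predualConjAux u a)‖ := by rw [hf _ _ h2]
        _ ≤ ‖predualConjAux u a‖ := norm_predualConjAux_le _ _ }

theorem predualConj_apply (u : unitary (Elem M)) (a : predual M) (m : Elem M) :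
    (predualConj u a).1 m = a.1 (Unitary.conjStarAlgAut ℂ (Elem M) (star u) m) := rfl

theorem predualConj_apply' (u : unitary (Elem M)) (a : predual M) (m : Elem M) :
    (predualConj u a).1 m = a.1 (star (u : Elem M) * m * u) := by
  rw [predualConj_apply, Unitary.conjStarAlgAut_star_apply]

theorem predualConj_ofVec [Countable ι] (u : unitary (Elem M)) (ξ η : L2 ι H) :
    predualConj u (ofVec M ξ η) = ofVec M (amp ι (u : Elem M).1 ξ) (amp ι (u : Elem M).1 η) :=
  predual_ext fun m => by
    rw [predualConj_apply', ofVec_apply, ofVec_apply, ← inner_amp_star_mul_mul]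
    rfl

theorem norm_unitary_apply (u : unitary (Elem M)) (v : H) : ‖(u : Elem M).1 v‖ = ‖v‖ := by
  refine (ContinuousLinearMap.norm_map_iff_adjoint_comp_self (u : Elem M).1).2 ?_ v
  exact congrArg Subtype.val (Unitary.coe_star_mul_self u)

theorem norm_amp_unitary (u : unitary (Elem M)) (ξ : L2 ι H) :
    ‖amp ι (u : Elem M).1 ξ‖ = ‖ξ‖ := by
  refine (ContinuousLinearMap.norm_map_iff_adjoint_comp_self (amp ι (u : Elem M).1)).2 ?_ ξ
  rw [adjoint_amp]
  have h : star (u : Elem M).1 * (u : Elem M).1 = 1 :=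
    congrArg Subtype.val (Unitary.coe_star_mul_self u)
  change amp ι (star (u : Elem M).1 * (u : Elem M).1) = 1
  rw [h]
  rfl

variable {X : Type*} [TopologicalSpace X]

/-- On the unitary group the weak operator topology is at least as fine as the ultrastrong one. -/
theorem continuous_amp_unitary (f : X → unitary (Elem M))
    (hf : ∀ v w : H, Continuous fun x => ⟪w, (f x : Elem M).1 v⟫_ℂ) (ξ : L2 ι H) :
    Continuous fun x => amp ι (f x : Elem M).1 ξ := by
  have hinner (η : L2 ι H) : Continuous fun x => ⟪η, amp ι (f x : Elem M).1 ξ⟫_ℂ := by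
    have hsum : Summable fun i => ‖η i‖ * ‖ξ i‖ := by
      refine Summable.of_nonneg_of_le (fun _ => by positivity) (fun i => ?_)
        ((L2.hasSum_norm_sq η).summable.add (L2.hasSum_norm_sq ξ).summable)
      nlinarith [sq_nonneg (‖η i‖ - ‖ξ i‖), sq_nonneg (‖η i‖), sq_nonneg (‖ξ i‖)]
    -- Weierstrass test: unitarity bounds the terms by `‖η i‖ * ‖ξ i‖` uniformly in `x`.
    have h := continuous_tsum (fun i => hf (ξ i) (η i)) hsum fun i x => by
      refine (norm_inner_le_norm _ _).trans (mul_le_mul_of_nonneg_left ?_ (norm_nonneg _))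
      exact (norm_unitary_apply (f x) (ξ i)).le
    refine h.congr fun x => ?_
    exact (hasSum_inner_amp (f x : Elem M).1 ξ η).tsum_eq
  refine continuous_iff_continuousAt.2 fun y => ?_
  rw [ContinuousAt, tendsto_iff_norm_sub_tendsto_zero]
  -- As both vectors have norm `‖ξ‖`, their distance depends only on an inner product; this turns
  -- weak continuity into norm continuity.
  have key (x) : ‖amp ι (f x : Elem M).1 ξ - amp ι (f y : Elem M).1 ξ‖ =
      Real.sqrt (2 * ‖ξ‖ ^ 2 -
        2 * (⟪amp ι (f y : Elem M).1 ξ, amp ι (f x : Elem M).1 ξ⟫_ℂ).re) := by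
    rw [← Real.sqrt_sq (norm_nonneg (amp ι (f x : Elem M).1 ξ - amp ι (f y : Elem M).1 ξ)),
      norm_sub_sq (𝕜 := ℂ), norm_amp_unitary, norm_amp_unitary, inner_re_symm]
    congr 1
    simp only [RCLike.re_eq_complex_re]
    ring
  simp only [key]
  have hc : Continuous fun x => Real.sqrt (2 * ‖ξ‖ ^ 2 -
      2 * (⟪amp ι (f y : Elem M).1 ξ, amp ι (f x : Elem M).1 ξ⟫_ℂ).re) :=
    Real.continuous_sqrt.comp (continuous_const.sub
      (continuous_const.mul (Complex.continuous_re.comp (hinner _))))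
  have h0 := hc.tendsto y
  rwa [← key y, sub_self, norm_zero] at h0

theorem continuous_predualConj (f : X → unitary (Elem M))
    (hf : ∀ v w : H, Continuous fun x => ⟪w, (f x : Elem M).1 v⟫_ℂ) (a : predual M) :
    Continuous fun x => predualConj (f x) a := by
  obtain ⟨ξ, η, rfl⟩ := exists_eq_ofVec a
  simp only [predualConj_ofVec]
  have hξ := continuous_amp_unitary f hf ξ
  have hη := continuous_amp_unitary f hf η
  refine continuous_iff_continuousAt.2 fun y => ?_
  rw [ContinuousAt, tendsto_iff_norm_sub_tendsto_zero]
  have hlim : Filter.Tendsto (fun x =>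
      ‖amp ℕ (f x : Elem M).1 ξ - amp ℕ (f y : Elem M).1 ξ‖ * ‖amp ℕ (f x : Elem M).1 η‖ +
      ‖amp ℕ (f y : Elem M).1 ξ‖ * ‖amp ℕ (f x : Elem M).1 η - amp ℕ (f y : Elem M).1 η‖)
      (𝓝 y) (𝓝 0) := by
    have hc : Continuous fun x =>
      ‖amp ℕ (f x : Elem M).1 ξ - amp ℕ (f y : Elem M).1 ξ‖ * ‖amp ℕ (f x : Elem M).1 η‖ +
      ‖amp ℕ (f y : Elem M).1 ξ‖ * ‖amp ℕ (f x : Elem M).1 η - amp ℕ (f y : Elem M).1 η‖ :=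
      ((hξ.sub continuous_const).norm.mul hη.norm).add
        (continuous_const.mul (hη.sub continuous_const).norm)
    simpa using hc.tendsto y
  refine squeeze_zero (fun _ => norm_nonneg _) (fun x => ?_) hlim
  have e : ofVec M (amp ℕ (f x : Elem M).1 ξ) (amp ℕ (f x : Elem M).1 η) -
      ofVec M (amp ℕ (f y : Elem M).1 ξ) (amp ℕ (f y : Elem M).1 η) =
      ofVec M (amp ℕ (f x : Elem M).1 ξ - amp ℕ (f y : Elem M).1 ξ) (amp ℕ (f x : Elem M).1 η) +
      ofVec M (amp ℕ (f y : Elem M).1 ξ)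
        (amp ℕ (f x : Elem M).1 η - amp ℕ (f y : Elem M).1 η) := by
    refine predual_ext fun m => ?_
    change ⟪_, amp ℕ (m : H →L[ℂ] H) _⟫_ℂ - ⟪_, amp ℕ (m : H →L[ℂ] H) _⟫_ℂ =
      ⟪_, amp ℕ (m : H →L[ℂ] H) _⟫_ℂ + ⟪_, amp ℕ (m : H →L[ℂ] H) _⟫_ℂ
    rw [map_sub, inner_sub_right, inner_sub_left]
    ring
  rw [e]
  exact (norm_add_le _ _).trans (add_le_add (norm_ofVec_le _ _ _) (norm_ofVec_le _ _ _))

end Conjugation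

/-! ### Compatibility of tensor functionals with conjugation, homomorphisms and reassociation -/

section TensorLinear

variable {H K : Type*} [NormedAddCommGroup H] [InnerProductSpace ℂ H] [CompleteSpace H]
  [NormedAddCommGroup K] [InnerProductSpace ℂ K] [CompleteSpace K]
  {M : VonNeumannAlgebra H} {N : VonNeumannAlgebra K}

theorem elemTensor_mul (m m' : Elem M) (n n' : Elem N) :
    elemTensor m n * elemTensor m' n' = elemTensor (m * m') (n * n') :=
  Subtype.ext (opTensor_mul _ _ _ _).symm

theorem star_elemTensor (m : Elem M) (n : Elem N) :
    star (elemTensor m n) = elemTensor (star m) (star n) :=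
  Subtype.ext (star_opTensor _ _)

theorem tensorFunctional_elemTensor (a : predual M) (b : predual N) (m : Elem M) (n : Elem N) :
    (tensorFunctional a b).1 (elemTensor m n) = a.1 m * b.1 n :=
  isTensorFunctional_tensorFunctional a b m n

/-- The tensor product of normal functionals as a bilinear map. -/
def tensorBilinear (M : VonNeumannAlgebra H) (N : VonNeumannAlgebra K) :
    predual M →ₗ[ℂ] predual N →ₗ[ℂ] predual (vnTensor M N) :=
  LinearMap.mk₂ ℂ tensorFunctional
    (fun a a' b => predual_vnTensor_ext fun m n => by
      change _ = (tensorFunctional a b).1 _ + (tensorFunctional a' b).1 _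
      simp only [tensorFunctional_elemTensor]
      exact add_mul _ _ _)
    (fun c a b => predual_vnTensor_ext fun m n => by
      change _ = c * (tensorFunctional a b).1 _
      simp only [tensorFunctional_elemTensor]
      exact mul_assoc _ _ _)
    (fun a b b' => predual_vnTensor_ext fun m n => by
      change _ = (tensorFunctional a b).1 _ + (tensorFunctional a b').1 _
      simp only [tensorFunctional_elemTensor]
      exact mul_add _ _ _)
    (fun c a b => predual_vnTensor_ext fun m n => by
      change _ = c * (tensorFunctional a b).1 _
      simp only [tensorFunctional_elemTensor]
      exact mul_left_comm _ _ _)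

/-- Conjugation by the tensor square of a unitary acts diagonally on tensor products. -/
theorem predualConj_tensorFunctional (u : unitary (Elem M)) (w : unitary (Elem (vnTensor M M)))
    (h : (w : Elem (vnTensor M M)) = elemTensor (u : Elem M) (u : Elem M)) (a b : predual M) :
    predualConj w (tensorFunctional a b) =
      tensorFunctional (predualConj u a) (predualConj u b) :=
  predual_vnTensor_ext fun m n => by
    rw [predualConj_apply', h, star_elemTensor, elemTensor_mul, elemTensor_mul,
      tensorFunctional_elemTensor, tensorFunctional_elemTensor, predualConj_apply',
      predualConj_apply']

theorem tensorFunctional_predualComp_left {H' : Type*} [NormedAddCommGroup H']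
    [InnerProductSpace ℂ H'] [CompleteSpace H'] {M' : VonNeumannAlgebra H'}
    {Φ : Elem M →⋆ₐ[ℂ] Elem M'} {hΦ : IsNormalMap Φ}
    (Ψ : Elem (vnTensor M N) →⋆ₐ[ℂ] Elem (vnTensor M' N)) (hΨ : IsNormalMap Ψ)
    (h : ∀ m n, Ψ (elemTensor m n) = elemTensor (Φ m) n) (a : predual M') (b : predual N) :
    tensorFunctional (predualComp Φ hΦ a) b = predualComp Ψ hΨ (tensorFunctional a b) := by
  refine predual_vnTensor_ext fun m n => ?_
  rw [tensorFunctional_elemTensor, predualComp_apply, predualComp_apply, h m n,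
    tensorFunctional_elemTensor]

theorem tensorFunctional_predualComp_right {K' : Type*} [NormedAddCommGroup K']
    [InnerProductSpace ℂ K'] [CompleteSpace K'] {N' : VonNeumannAlgebra K'}
    {Φ : Elem N →⋆ₐ[ℂ] Elem N'} {hΦ : IsNormalMap Φ}
    (Ψ : Elem (vnTensor M N) →⋆ₐ[ℂ] Elem (vnTensor M N')) (hΨ : IsNormalMap Ψ)
    (h : ∀ m n, Ψ (elemTensor m n) = elemTensor m (Φ n)) (a : predual M) (b : predual N') :
    tensorFunctional a (predualComp Φ hΦ b) = predualComp Ψ hΨ (tensorFunctional a b) := by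
  refine predual_vnTensor_ext fun m n => ?_
  rw [tensorFunctional_elemTensor, predualComp_apply, predualComp_apply, h m n,
    tensorFunctional_elemTensor]

/-- Conjugation commutes with the pre-adjoint of a normal homomorphism. -/
theorem predualConj_predualComp {Φ : Elem M →⋆ₐ[ℂ] Elem N} {hΦ : IsNormalMap Φ}
    (u : unitary (Elem M)) (w : unitary (Elem N)) (h : Φ u = w) (a : predual N) :
    predualConj u (predualComp Φ hΦ a) = predualComp Φ hΦ (predualConj w a) := by
  refine predual_ext fun m => ?_
  rw [predualConj_apply', predualComp_apply, predualComp_apply, predualConj_apply', map_mul Φ,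
    map_mul Φ, map_star Φ, h]

/-- In vector representatives both sides are sums over triples of matrix coefficients at elementary
tensors. These agree term by term after reindexing, so no associator unitary has to be constructed.
-/
theorem tensorFunctional_assoc_of_forall_inner {H₁ H₂ H₃ : Type*} [NormedAddCommGroup H₁]
    [InnerProductSpace ℂ H₁] [CompleteSpace H₁] [NormedAddCommGroup H₂] [InnerProductSpace ℂ H₂]
    [CompleteSpace H₂] [NormedAddCommGroup H₃] [InnerProductSpace ℂ H₃] [CompleteSpace H₃]
    {M₁ : VonNeumannAlgebra H₁} {M₂ : VonNeumannAlgebra H₂} {M₃ : VonNeumannAlgebra H₃}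
    (a : predual M₁) (b : predual M₂) (c : predual M₃)
    (S : Elem (vnTensor (vnTensor M₁ M₂) M₃)) (T : Elem (vnTensor M₁ (vnTensor M₂ M₃)))
    (h : ∀ ξ₁ ξ₂ ξ₃ η₁ η₂ η₃,
      ⟪vecTensor (vecTensor η₁ η₂) η₃, S.1 (vecTensor (vecTensor ξ₁ ξ₂) ξ₃)⟫_ℂ =
      ⟪vecTensor η₁ (vecTensor η₂ η₃), T.1 (vecTensor ξ₁ (vecTensor ξ₂ ξ₃))⟫_ℂ) :
    (tensorFunctional (tensorFunctional a b) c).1 S =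
      (tensorFunctional a (tensorFunctional b c)).1 T := by
  have ea := exists_eq_ofVec a
  have eb := exists_eq_ofVec b
  have ec := exists_eq_ofVec c
  obtain ⟨ξ₁, η₁, ha⟩ := ea
  obtain ⟨ξ₂, η₂, hb⟩ := eb
  obtain ⟨ξ₃, η₃, hc⟩ := ec
  have hab : tensorFunctional a b = ofVec _ (tensorFamily ξ₁ ξ₂) (tensorFamily η₁ η₂) := by
    rw [ha, hb, tensorFunctional_ofVec]
  have hbc : tensorFunctional b c = ofVec _ (tensorFamily ξ₂ ξ₃) (tensorFamily η₂ η₃) := by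
    rw [hb, hc, tensorFunctional_ofVec]
  have hS := (congrArg₂ tensorFunctional hab hc).trans (tensorFunctional_ofVec _ _ _ _ _ _)
  have hT := (congrArg₂ tensorFunctional ha hbc).trans (tensorFunctional_ofVec _ _ _ _ _ _)
  have sS := hasSum_ofVec (vnTensor (vnTensor M₁ M₂) M₃)
    (tensorFamily (tensorFamily ξ₁ ξ₂) ξ₃) (tensorFamily (tensorFamily η₁ η₂) η₃) S
  have sT := (Equiv.prodAssoc ℕ ℕ ℕ).hasSum_iff.2 (hasSum_ofVec (vnTensor M₁ (vnTensor M₂ M₃))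
    (tensorFamily ξ₁ (tensorFamily ξ₂ ξ₃)) (tensorFamily η₁ (tensorFamily η₂ η₃)) T)
  have sST := sT.congr_fun fun p => h (ξ₁ p.1.1) (ξ₂ p.1.2) (ξ₃ p.2) (η₁ p.1.1) (η₂ p.1.2) (η₃ p.2)
  exact (congrArg (fun φ : predual (vnTensor (vnTensor M₁ M₂) M₃) => φ.1 S) hS).trans
    ((sS.unique sST).trans
      (congrArg (fun φ : predual (vnTensor M₁ (vnTensor M₂ M₃)) => φ.1 T) hT).symm)

end TensorLinear

/-! ### The convolution algebra and the action of the intrinsic group -/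

namespace HopfVonNeumannAlgebra

variable {H : Type*} [NormedAddCommGroup H] [InnerProductSpace ℂ H] [CompleteSpace H]
  (𝓗 : HopfVonNeumannAlgebra H)

/-- The convolution product on the predual. -/
def convolution : predual 𝓗.M →ₗ[ℂ] predual 𝓗.M →ₗ[ℂ] predual 𝓗.M :=
  (tensorBilinear 𝓗.M 𝓗.M).compr₂ (predualComp 𝓗.Γ 𝓗.normal)

theorem convolution_eq (a b : predual 𝓗.M) :
    𝓗.convolution a b = predualComp 𝓗.Γ 𝓗.normal (tensorFunctional a b) := rfl

theorem norm_convolution_le (a b : predual 𝓗.M) : ‖𝓗.convolution a b‖ ≤ ‖a‖ * ‖b‖ :=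
  (norm_predualComp_le 𝓗.Γ 𝓗.normal _).trans (norm_tensorFunctional_le a b)

theorem convolution_assoc (a b c : predual 𝓗.M) :
    𝓗.convolution (𝓗.convolution a b) c = 𝓗.convolution a (𝓗.convolution b c) := by
  obtain ⟨Γι, ιΓ, hΓι, eΓι, hιΓ, eιΓ, hco⟩ := 𝓗.coassociative
  have h1 := tensorFunctional_predualComp_left (hΦ := 𝓗.normal) Γι hΓι eΓι
    (tensorFunctional a b) c
  have h2 := tensorFunctional_predualComp_right (hΦ := 𝓗.normal) ιΓ hιΓ eιΓ a
    (tensorFunctional b c)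
  refine predual_ext fun m => ?_
  exact (congrArg (fun φ : predual (vnTensor 𝓗.M 𝓗.M) => φ.1 (𝓗.Γ m)) h1).trans
    ((tensorFunctional_assoc_of_forall_inner a b c _ _ (hco m)).trans
      (congrArg (fun φ : predual (vnTensor 𝓗.M 𝓗.M) => φ.1 (𝓗.Γ m)) h2).symm)

variable {𝓗}

theorem gamma_intrinsicGroup (x : 𝓗.intrinsicGroup) :
    𝓗.Γ ((x : (Elem 𝓗.M)ˣ) : Elem 𝓗.M) =
      elemTensor ((x : (Elem 𝓗.M)ˣ) : Elem 𝓗.M) ((x : (Elem 𝓗.M)ˣ) : Elem 𝓗.M) := x.2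

theorem norm_apply_le_of_mem_intrinsicGroup (x : 𝓗.intrinsicGroup) (v : H) :
    ‖((x : (Elem 𝓗.M)ˣ) : Elem 𝓗.M).1 v‖ ≤ ‖v‖ := by
  set T : H →L[ℂ] H := ((x : (Elem 𝓗.M)ˣ) : Elem 𝓗.M).1 with hT
  have hn : ‖opTensor T T‖ = ‖T‖ :=
    (congrArg norm (gamma_intrinsicGroup x)).symm.trans
      (norm_starAlgHom_apply 𝓗.Γ 𝓗.injective _)
  -- The bound on `w ⊗ w` reads `‖T w‖² ≤ ‖T‖ ‖w‖²`; hence `‖T‖ ≤ √‖T‖`, which forces `‖T‖ ≤ 1`.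
  have hsq (w : H) : ‖T w‖ ≤ Real.sqrt ‖T‖ * ‖w‖ := by
    have h := norm_mul_norm_le_opTensor T T w w
    rw [hn] at h
    refine (sq_le_sq₀ (norm_nonneg _) (by positivity)).1 ?_
    rwa [mul_pow, Real.sq_sqrt (norm_nonneg _), sq, sq]
  have h1 : ‖T‖ ≤ 1 := by
    have h := T.opNorm_le_bound (Real.sqrt_nonneg _) hsq
    have h2 := Real.sq_sqrt (norm_nonneg T)
    by_contra hc
    have : 1 < Real.sqrt ‖T‖ := lt_of_lt_of_le (by linarith) h
    nlinarith
  exact (T.le_opNorm v).trans (mul_le_of_le_one_left (norm_nonneg _) h1)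

theorem mem_unitary_of_mem_intrinsicGroup (x : 𝓗.intrinsicGroup) :
    ((x : (Elem 𝓗.M)ˣ) : Elem 𝓗.M) ∈ unitary (Elem 𝓗.M) := by
  set T : H →L[ℂ] H := ((x : (Elem 𝓗.M)ˣ) : Elem 𝓗.M).1 with hT
  have hnorm (v : H) : ‖T v‖ = ‖v‖ := by
    refine le_antisymm (norm_apply_le_of_mem_intrinsicGroup x v) ?_
    -- The inverse is also in the group and hence a contraction, which gives the reverse inequality.
    have h := norm_apply_le_of_mem_intrinsicGroup x⁻¹ (T v)
    have e : ((x⁻¹ : 𝓗.intrinsicGroup) : (Elem 𝓗.M)ˣ).1.1 * T = 1 :=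
      congrArg Subtype.val (Units.inv_mul (x : (Elem 𝓗.M)ˣ))
    exact (congrArg norm (congrArg (fun f : H →L[ℂ] H => f v) e)).symm.trans_le h
  have h1 : star ((x : (Elem 𝓗.M)ˣ) : Elem 𝓗.M) * ((x : (Elem 𝓗.M)ˣ) : Elem 𝓗.M) = 1 :=
    Subtype.ext ((ContinuousLinearMap.norm_map_iff_adjoint_comp_self T).1 hnorm)
  refine Unitary.mem_iff.2 ⟨h1, ?_⟩
  rw [left_inv_eq_right_inv h1 (Units.mul_inv _), Units.mul_inv]

/-- The inclusion of the intrinsic group in the unitary group. -/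
def toUnitary : 𝓗.intrinsicGroup →* unitary (Elem 𝓗.M) where
  toFun x := ⟨((x : (Elem 𝓗.M)ˣ) : Elem 𝓗.M), mem_unitary_of_mem_intrinsicGroup x⟩
  map_one' := rfl
  map_mul' _ _ := rfl

theorem star_toUnitary (x : 𝓗.intrinsicGroup) :
    star (toUnitary x : Elem 𝓗.M) = (((x : (Elem 𝓗.M)ˣ)⁻¹ : (Elem 𝓗.M)ˣ) : Elem 𝓗.M) :=
  left_inv_eq_right_inv (Unitary.coe_star_mul_self (toUnitary x)) (Units.mul_inv _)

/-- Conjugation by `x` passes through the pre-adjoint of `Γ` as conjugation by `Γ x = x ⊗ x`, which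
acts on each tensor factor separately. -/
theorem predualConj_convolution (x : 𝓗.intrinsicGroup) (a b : predual 𝓗.M) :
    predualConj (toUnitary x) (𝓗.convolution a b) =
      𝓗.convolution (predualConj (toUnitary x) a) (predualConj (toUnitary x) b) := by
  have hmem : 𝓗.Γ (toUnitary x : Elem 𝓗.M) ∈ unitary (Elem (vnTensor 𝓗.M 𝓗.M)) :=
    Unitary.map_mem 𝓗.Γ (toUnitary x).2
  rw [convolution_eq, convolution_eq, ← predualConj_tensorFunctional (toUnitary x) ⟨_, hmem⟩
    (gamma_intrinsicGroup x)]
  exact predualConj_predualComp (toUnitary x) ⟨_, hmem⟩ rfl _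

variable (𝓗)

/-- The action of the intrinsic group on the predual. -/
def predualAction : 𝓗.intrinsicGroup →* (predual 𝓗.M ≃ₗᵢ[ℂ] predual 𝓗.M) where
  toFun x := predualConj (toUnitary x)
  map_one' := LinearIsometryEquiv.ext fun a => predual_ext fun m => by
    rw [predualConj_apply, map_one, star_one, map_one]
    rfl
  map_mul' x y := LinearIsometryEquiv.ext fun a => predual_ext fun m => by
    rw [predualConj_apply, map_mul, star_mul, Unitary.conjStarAlgAut_mul_apply]
    rfl

/-- The conjugation action of the intrinsic group on the von Neumann algebra. -/
def conjAction : 𝓗.intrinsicGroup →* (Elem 𝓗.M ≃⋆ₐ[ℂ] Elem 𝓗.M) :=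
  (Unitary.conjStarAlgAut ℂ (Elem 𝓗.M)).comp toUnitary

theorem conjAction_apply (x : 𝓗.intrinsicGroup) (m : Elem 𝓗.M) :
    𝓗.conjAction x m = ((x : (Elem 𝓗.M)ˣ) : Elem 𝓗.M) * m *
      (((x : (Elem 𝓗.M)ˣ)⁻¹ : (Elem 𝓗.M)ˣ) : Elem 𝓗.M) := by
  rw [← star_toUnitary]
  rfl

theorem star_toUnitary_eq_inv (x : 𝓗.intrinsicGroup) : star (toUnitary x) = toUnitary x⁻¹ := by
  rw [map_inv, Unitary.star_eq_inv]

theorem predualAction_apply (x : 𝓗.intrinsicGroup) (a : predual 𝓗.M) (m : Elem 𝓗.M) :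
    (𝓗.predualAction x a).1 m = a.1 (𝓗.conjAction x⁻¹ m) := by
  change a.1 (Unitary.conjStarAlgAut ℂ (Elem 𝓗.M) (star (toUnitary x)) m) = _
  rw [star_toUnitary_eq_inv]
  rfl

theorem continuous_inner_intrinsicGroup (v w : H) :
    Continuous[𝓗.intrinsicTopology, inferInstance] fun x : 𝓗.intrinsicGroup =>
      ⟪w, (toUnitary x : Elem 𝓗.M).1 v⟫_ℂ := by
  let _ := 𝓗.intrinsicTopology
  have h : Continuous fun x : 𝓗.intrinsicGroup => ContinuousLinearMapWOT.ofCLM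
      (((x : (Elem 𝓗.M)ˣ) : Elem 𝓗.M) : H →L[ℂ] H) := continuous_induced_dom
  exact ContinuousLinearMapWOT.continuous_iff.1 h v w

theorem continuous_predualAction (a : predual 𝓗.M) :
    Continuous[𝓗.intrinsicTopology, inferInstance]
      fun x : 𝓗.intrinsicGroup => 𝓗.predualAction x a := by
  let _ := 𝓗.intrinsicTopology
  exact continuous_predualConj _ 𝓗.continuous_inner_intrinsicGroup a

theorem continuous_conjAction (m : Elem 𝓗.M) (a : predual 𝓗.M) :
    Continuous[𝓗.intrinsicTopology, inferInstance]
      fun x : 𝓗.intrinsicGroup => a.1 (𝓗.conjAction x m) := by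
  let _ := 𝓗.intrinsicTopology
  -- Taking adjoints is weakly continuous, so norm continuity on the predual also holds along `x ↦
  -- x⋆`; evaluation at `m` then gives the weak⋆ continuity of `α`.
  have h := continuous_predualConj (M := 𝓗.M) (fun x : 𝓗.intrinsicGroup => star (toUnitary x))
    (fun v w => by
      have h := Complex.continuous_conj.comp (𝓗.continuous_inner_intrinsicGroup w v)
      refine h.congr fun x => ?_
      change starRingEnd ℂ ⟪v, (toUnitary x : Elem 𝓗.M).1 w⟫_ℂ =
        ⟪w, ContinuousLinearMap.adjoint (toUnitary x : Elem 𝓗.M).1 v⟫_ℂ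
      rw [inner_conj_symm, ContinuousLinearMap.adjoint_inner_right]) a
  have h' := (ContinuousLinearMap.apply ℂ ℂ m).continuous.comp (continuous_subtype_val.comp h)
  refine h'.congr fun x => ?_
  change (predualConj (star (toUnitary x)) a).1 m = _
  rw [predualConj_apply, star_star]
  rfl

end HopfVonNeumannAlgebra

end HopfVN

end

theorem proposition6p1 {H : Type*} [NormedAddCommGroup H] [InnerProductSpace ℂ H]
    [CompleteSpace H] (𝓗 : HopfVN.HopfVonNeumannAlgebra H) :
    -- the conjugation action `α` of the intrinsic group on `M`
    ∃ α : 𝓗.intrinsicGroup →* (HopfVN.Elem 𝓗.M ≃⋆ₐ[ℂ] HopfVN.Elem 𝓗.M),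
      (∀ (x : 𝓗.intrinsicGroup) (m : HopfVN.Elem 𝓗.M),
        α x m = ((x : (HopfVN.Elem 𝓗.M)ˣ) : HopfVN.Elem 𝓗.M) * m *
          (((x : (HopfVN.Elem 𝓗.M)ˣ)⁻¹ : (HopfVN.Elem 𝓗.M)ˣ) : HopfVN.Elem 𝓗.M)) ∧
      (∀ (m : HopfVN.Elem 𝓗.M) (a : HopfVN.predual 𝓗.M),
        Continuous[𝓗.intrinsicTopology, inferInstance]
          fun x : 𝓗.intrinsicGroup => a.1 (α x m)) ∧
      -- (a): the predual is a Banach algebra for the product dual to the comultiplication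
      CompleteSpace (HopfVN.predual 𝓗.M) ∧
      (∀ a b : HopfVN.predual 𝓗.M, ∃! ψ : HopfVN.predual (HopfVN.vnTensor 𝓗.M 𝓗.M),
        HopfVN.IsTensorFunctional a b ψ) ∧
      ∃ mul : HopfVN.predual 𝓗.M →ₗ[ℂ] HopfVN.predual 𝓗.M →ₗ[ℂ] HopfVN.predual 𝓗.M,
        (∀ (a b : HopfVN.predual 𝓗.M) (ψ : HopfVN.predual (HopfVN.vnTensor 𝓗.M 𝓗.M)),
          HopfVN.IsTensorFunctional a b ψ →
            ∀ m : HopfVN.Elem 𝓗.M, (mul a b).1 m = ψ.1 (𝓗.Γ m)) ∧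
        (∀ a b c : HopfVN.predual 𝓗.M, mul (mul a b) c = mul a (mul b c)) ∧
        (∀ a b : HopfVN.predual 𝓗.M, ‖mul a b‖ ≤ ‖a‖ * ‖b‖) ∧
        -- (b): `β` acts on the predual by isometric algebra automorphisms
        ∃ β : 𝓗.intrinsicGroup →* (HopfVN.predual 𝓗.M ≃ₗᵢ[ℂ] HopfVN.predual 𝓗.M),
          (∀ (x : 𝓗.intrinsicGroup) (a : HopfVN.predual 𝓗.M) (m : HopfVN.Elem 𝓗.M),
            (β x a).1 m = a.1 (α x⁻¹ m)) ∧
          (∀ (x : 𝓗.intrinsicGroup) (a b : HopfVN.predual 𝓗.M),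
            β x (mul a b) = mul (β x a) (β x b)) ∧
          (∀ a : HopfVN.predual 𝓗.M,
            Continuous[𝓗.intrinsicTopology, inferInstance]
              fun x : 𝓗.intrinsicGroup => β x a) := by
  refine ⟨𝓗.conjAction, 𝓗.conjAction_apply, 𝓗.continuous_conjAction,
    HopfVN.completeSpace_predual 𝓗.M, HopfVN.existsUnique_isTensorFunctional, 𝓗.convolution,
    fun a b ψ hψ m => ?_, 𝓗.convolution_assoc, 𝓗.norm_convolution_le, 𝓗.predualAction,
    𝓗.predualAction_apply, HopfVN.HopfVonNeumannAlgebra.predualConj_convolution,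
    𝓗.continuous_predualAction⟩
  rw [hψ.eq_tensorFunctional]
  rfl
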